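/- Let $\sigma,\nu>0$. Let $\mathbb{BC}=\{Z=z_1+jz_2:\ z_1,z_2\in\mathbb C\}$, with $j^2=-1$ and $ij=ji$, be the commutative algebra of bicomplex numbers. Put $e_\pm=\tfrac12(1\pm ij)$ and write $Z=\alpha e_++\beta e_-$ with $\alpha=z_1-iz_2$, $\beta=z_1+iz_2$; put $Z^*=\overline{z_1}-j\,\overline{z_2}=\overline\alpha e_++\overline\beta e_-$, $|Z|^2=|z_1|^2+|z_2|^2$ and $e^Z=e^\alpha e_++e^\beta e_-$, and let $\lambda$ be Lebesgue measure on $\mathbb{BC}\cong\mathbb R^4$. Let $L^{2,\sigma}_{\mathbb{BC}}(\mathbb R)$ be the $\mathbb{BC}$-module of (classes modulo a.e. equality of) measurable functions $\varphi:\mathbb R\to\mathbb{BC}$ with $\int_{\mathbb R}|\varphi(x)|^2e^{-\sigma x^2}dx<\infty$, with the bicomplex inner product $$\langle\varphi,\psi\rangle_{L^{2,\sigma}_{\mathbb{BC}}(\mathbb R)}=c_0^\sigma\int_{\mathbb R}\varphi(x)\psi(x)^*e^{-\sigma x^2}dx,\qquad c_0^\sigma=\Big(\frac\sigma\pi\Big)^{1/2}.$$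 A function $f:\mathbb{BC}\to\mathbb{BC}$ is bicomplex holomorphic if at every $Z_0\in\mathbb{BC}$ the limit of $(f(Z_0+H)-f(Z_0))/H$ exists in $\mathbb{BC}$ as $H\to0$ through invertible $H$. Let $\mathcal F^{2,\nu}(\mathbb{BC})$ be the $\mathbb{BC}$-module of bicomplex holomorphic functions $f$ with $\int_{\mathbb{BC}}|f(Z)|^2e^{-\nu|Z|^2}d\lambda(Z)<\infty$, with the bicomplex inner product $$\langle f,g\rangle_{\mathcal F^{2,\nu}(\mathbb{BC})}=\Big(\frac\nu\pi\Big)^2\int_{\mathbb{BC}}f(Z)g(Z)^*e^{-\nu|Z|^2}d\lambda(Z).$$ In both spaces the norm is given by $\|\varphi\|^2=\tfrac12(a+b)$, where $\langle\varphi,\varphi\rangle=ae_++be_-$. For $\varphi\in L^{2,\sigma}_{\mathbb{BC}}(\mathbb R)$ and $Z\in\mathbb{BC}$ the integral $$\mathcal B^{\sigma,\nu}_{\mathbb{BC}}\varphi(Z)=c_0^\sigma\int_{\mathbb R}e^{-\sigma\left(x-\sqrt{\nu/(4\sigma)}\,Z\right)^2}\varphi(x)\,dx$$ converges absolutely, and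 the transform $\mathcal B^{\sigma,\nu}_{\mathbb{BC}}$ so defined is a $\mathbb{BC}$-linear bijection of $L^{2,\sigma}_{\mathbb{BC}}(\mathbb R)$ onto $\mathcal F^{2,\nu}(\mathbb{BC})$ which is unitary, that is, $\langle\mathcal B^{\sigma,\nu}_{\mathbb{BC}}\varphi,\mathcal B^{\sigma,\nu}_{\mathbb{BC}}\psi\rangle_{\mathcal F^{2,\nu}(\mathbb{BC})}=\langle\varphi,\psi\rangle_{L^{2,\sigma}_{\mathbb{BC}}(\mathbb R)}$ for all $\varphi,\psi$, and isometric, that is, $\|\mathcal B^{\sigma,\nu}_{\mathbb{BC}}\varphi\|=\|\varphi\|$ for all $\varphi$. Moreover, for every integer $n\ge0$, it sends the normalized Hermite function $$\psi_n^\sigma(x)=\Big(\frac1{2^n\sigma^nn!}\Big)^{1/2}(-1)^ne^{\sigma x^2}\frac{d^n}{dx^n}\big(e^{-\sigma x^2}\big)\in L^{2,\sigma}_{\mathbb{BC}}(\mathbb R)$$ to the normalized monomial $\phi_n(Z)=\big(\frac{\nu^n}{2^nn!}\big)^{1/2}Z^n$, where $\langle\psi_m^\sigma,\psi_n^\sigma\rangle=\langle\phi_m,\phi_n\rangle=\delta_{m,n}$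 for all $m,n\ge 0$. -/

import Mathlib

open MeasureTheory Filter Topology

noncomputable section

/-- Bicomplex numbers `Z = z₁ + j z₂` with `z₁, z₂ ∈ ℂ` (the fields `Z.re` and `Z.im`),
`j² = -1` and `i j = j i`: the commutative quadratic algebra `ℂ[j] / (j² + 1)`. -/
abbrev Bicomplex : Type := QuadraticAlgebra ℂ (-1) 0

namespace Bicomplex

/-- The second imaginary unit. -/
def j : Bicomplex := ⟨0, 1⟩

/-- `e₊ = (1 + i j) / 2`. -/
def ePlus : Bicomplex := (1 / 2 : ℂ) • (1 + Complex.I • j)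

/-- `e₋ = (1 - i j) / 2`. -/
def eMinus : Bicomplex := (1 / 2 : ℂ) • (1 - Complex.I • j)

/-- The coefficient `α = z₁ - i z₂` in `Z = α e₊ + β e₋`. -/
def plusPart (Z : Bicomplex) : ℂ := Z.re - Complex.I * Z.im

/-- The coefficient `β = z₁ + i z₂` in `Z = α e₊ + β e₋`. -/
def minusPart (Z : Bicomplex) : ℂ := Z.re + Complex.I * Z.im

theorem eq_idempotent (Z : Bicomplex) :
    Z = plusPart Z • ePlus + minusPart Z • eMinus := by
  ext
  · simp [plusPart, minusPart, ePlus, eMinus, j, QuadraticAlgebra.re_one]; ring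
  · simp [plusPart, minusPart, ePlus, eMinus, j, QuadraticAlgebra.im_one]
    ring_nf
    simp

/-- The conjugation `Z* = conj z₁ - j conj z₂`. -/
def conjStar (Z : Bicomplex) : Bicomplex := ⟨starRingEnd ℂ Z.re, -starRingEnd ℂ Z.im⟩

/-- The bicomplex exponential `exp (α e₊ + β e₋) = exp α e₊ + exp β e₋`. -/
def exp (Z : Bicomplex) : Bicomplex :=
  Complex.exp (plusPart Z) • ePlus + Complex.exp (minusPart Z) • eMinus

/-- The null cone `{z₁ + j z₂ : z₁² + z₂² = 0}`. -/
def nullCone : Set Bicomplex := {Z | Z.re ^ 2 + Z.im ^ 2 = 0}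

/-- The identification of bicomplex numbers with the Hermitian space `ℂ²`. -/
def toEuclidean : Bicomplex ≃ₗ[ℂ] WithLp 2 (ℂ × ℂ) where
  toFun Z := WithLp.toLp 2 (Z.re, Z.im)
  invFun p := ⟨p.fst, p.snd⟩
  map_add' _ _ := rfl
  map_smul' _ _ := rfl
  left_inv _ := rfl
  right_inv _ := rfl

/-- The Euclidean norm `|Z|² = |z₁|² + |z₂|²`. -/
instance : NormedAddCommGroup Bicomplex :=
  NormedAddCommGroup.induced Bicomplex (WithLp 2 (ℂ × ℂ)) toEuclidean toEuclidean.injective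

instance : NormedSpace ℂ Bicomplex := NormedSpace.induced ℂ Bicomplex (WithLp 2 (ℂ × ℂ)) toEuclidean

theorem norm_sq_eq (Z : Bicomplex) : ‖Z‖ ^ 2 = ‖Z.re‖ ^ 2 + ‖Z.im‖ ^ 2 :=
  WithLp.prod_norm_sq_eq_of_L2 (toEuclidean Z)

instance : CompleteSpace Bicomplex := FiniteDimensional.complete ℂ Bicomplex

instance : ProperSpace Bicomplex := FiniteDimensional.proper ℂ Bicomplex

theorem continuous_re : Continuous (fun Z : Bicomplex => Z.re) :=
  (QuadraticAlgebra.reₗ (-1 : ℂ) 0).continuous_of_finiteDimensional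

theorem continuous_im : Continuous (fun Z : Bicomplex => Z.im) :=
  (QuadraticAlgebra.imₗ (-1 : ℂ) 0).continuous_of_finiteDimensional

theorem norm_mul_le' (Z W : Bicomplex) : ‖Z * W‖ ≤ 2 * (‖Z‖ * ‖W‖) := by
  have h1 := norm_add_le (Z.re * W.re) (-(Z.im * W.im))
  have h2 := norm_add_le (Z.re * W.im) (Z.im * W.re)
  rw [norm_neg, norm_mul, norm_mul] at h1
  rw [norm_mul, norm_mul] at h2
  have h := norm_sq_eq (Z * W)
  have hre : (Z * W).re = Z.re * W.re + -(Z.im * W.im) := by simp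
  have him : (Z * W).im = Z.re * W.im + Z.im * W.re := by simp
  rw [hre, him] at h
  have h3 := pow_le_pow_left₀ (norm_nonneg _) h1 2
  have h4 := pow_le_pow_left₀ (norm_nonneg _) h2 2
  refine le_of_sq_le_sq ?_ (by positivity)
  rw [h, mul_pow, mul_pow, norm_sq_eq Z, norm_sq_eq W]
  nlinarith [sq_nonneg (‖Z.re‖ * ‖W.re‖ - ‖Z.im‖ * ‖W.im‖),
    sq_nonneg (‖Z.re‖ * ‖W.im‖ - ‖Z.im‖ * ‖W.re‖)]

instance : ContinuousMul Bicomplex where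
  continuous_mul := by
    have h : Continuous (toEuclidean.symm.toLinearMap) :=
      LinearMap.continuous_of_finiteDimensional _
    have hre := continuous_re
    have him := continuous_im
    have := h.comp (g := toEuclidean.symm) (f := fun p : Bicomplex × Bicomplex =>
      WithLp.toLp 2 ((p.1 * p.2).re, (p.1 * p.2).im)) (by
        simp only [QuadraticAlgebra.re_mul, QuadraticAlgebra.im_mul]
        fun_prop)
    exact this

instance : ContinuousConstSMul Bicomplex Bicomplex where
  continuous_const_smul _ := continuous_const.mul continuous_id

instance : MeasurableSpace Bicomplex := borel Bicomplex

instance : BorelSpace Bicomplex := ⟨rfl⟩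

/-- Lebesgue measure on bicomplex numbers, identified with `ℂ × ℂ = ℝ⁴` by `z₁ + j z₂ ↔ (z₁, z₂)`. -/
instance : MeasureSpace Bicomplex where
  volume := Measure.map (fun p : ℂ × ℂ => (⟨p.1, p.2⟩ : Bicomplex)) volume

/-- The map that transports Lebesgue measure is a homeomorphism, so the pushforward above is
the intended one. -/
theorem isHomeomorph_mk : IsHomeomorph (fun p : ℂ × ℂ => (⟨p.1, p.2⟩ : Bicomplex)) := by
  have h : Continuous (toEuclidean.symm.toLinearMap) :=
    LinearMap.continuous_of_finiteDimensional _
  have h' : Continuous (fun p : ℂ × ℂ => (⟨p.1, p.2⟩ : Bicomplex)) :=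
    h.comp (WithLp.prod_continuous_toLp 2 ℂ ℂ)
  exact (Homeomorph.mk (QuadraticAlgebra.equivProd (-1 : ℂ) 0).symm h'
    (continuous_re.prodMk continuous_im)).isHomeomorph

/-- The norm induced by a bicomplex inner product `⟨φ, φ⟩ = a e₊ + b e₋`, as a function of the
value `W = ⟨φ, φ⟩`: its square is `(a + b) / 2`. -/
def inducedNorm (W : Bicomplex) : ℝ := √(((plusPart W).re + (minusPart W).re) / 2)

/-- `f` has a bicomplex derivative at every point: the difference quotients along increments
outside the null cone (which are the invertible ones) converge. -/
def IsHolomorphic (f : Bicomplex → Bicomplex) : Prop :=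
  ∀ Z₀ : Bicomplex, ∃ L : Bicomplex,
    Tendsto (fun H : Bicomplex => (f (Z₀ + H) - f Z₀) * Ring.inverse H) (𝓝[nullConeᶜ] 0) (𝓝 L)

/-- The module of bicomplex holomorphic functions on the bicomplex numbers. -/
def holomorphicFunctions : Submodule Bicomplex (Bicomplex → Bicomplex) where
  carrier := {f | IsHolomorphic f}
  add_mem' {f g} hf hg Z := by
    obtain ⟨L, hL⟩ := hf Z
    obtain ⟨M, hM⟩ := hg Z
    refine ⟨L + M, (hL.add hM).congr fun H => ?_⟩
    simp only [Pi.add_apply]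
    ring
  zero_mem' Z := ⟨0, by simpa using tendsto_const_nhds⟩
  smul_mem' c f hf Z := by
    obtain ⟨L, hL⟩ := hf Z
    refine ⟨c * L, (hL.const_mul c).congr fun H => ?_⟩
    simp only [Pi.smul_apply, smul_eq_mul]
    ring

theorem sq_norm_add_le (Z W : Bicomplex) : ‖Z + W‖ ^ 2 ≤ 2 * (‖Z‖ ^ 2 + ‖W‖ ^ 2) :=
  (pow_le_pow_left₀ (norm_nonneg _) (norm_add_le Z W) 2).trans
    (by nlinarith [sq_nonneg (‖Z‖ - ‖W‖)])

theorem sq_norm_mul_le (Z W : Bicomplex) : ‖Z * W‖ ^ 2 ≤ 4 * ‖Z‖ ^ 2 * ‖W‖ ^ 2 :=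
  (pow_le_pow_left₀ (norm_nonneg _) (norm_mul_le' Z W) 2).trans (by nlinarith)

theorem integrable_add {X : Type*} [MeasurableSpace X] {μ : Measure X} {w : X → ℝ}
    {f g : X → Bicomplex} (hw : Measurable w) (hw0 : ∀ x, 0 ≤ w x)
    (hfm : AEStronglyMeasurable f μ) (hgm : AEStronglyMeasurable g μ)
    (hf : Integrable (fun x => w x * ‖f x‖ ^ 2) μ) (hg : Integrable (fun x => w x * ‖g x‖ ^ 2) μ) :
    Integrable (fun x => w x * ‖f x + g x‖ ^ 2) μ := by
  refine ((hf.add hg).const_mul 2).mono'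
    (hw.aestronglyMeasurable.mul ((hfm.add hgm).norm.pow 2)) (ae_of_all _ fun x => ?_)
  rw [Real.norm_of_nonneg (mul_nonneg (hw0 x) (sq_nonneg _))]
  have := mul_le_mul_of_nonneg_left (sq_norm_add_le (f x) (g x)) (hw0 x)
  simp only [Pi.add_apply]
  linarith

theorem integrable_mul {X : Type*} [MeasurableSpace X] {μ : Measure X} {w : X → ℝ}
    {f : X → Bicomplex} (c : Bicomplex) (hw : Measurable w) (hw0 : ∀ x, 0 ≤ w x)
    (hfm : AEStronglyMeasurable f μ) (hf : Integrable (fun x => w x * ‖f x‖ ^ 2) μ) :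
    Integrable (fun x => w x * ‖c * f x‖ ^ 2) μ := by
  refine (hf.const_mul (4 * ‖c‖ ^ 2)).mono'
    (hw.aestronglyMeasurable.mul (((hfm.const_smul c).norm).pow 2)) (ae_of_all _ fun x => ?_)
  rw [Real.norm_of_nonneg (mul_nonneg (hw0 x) (sq_nonneg _))]
  have := mul_le_mul_of_nonneg_left (sq_norm_mul_le c (f x)) (hw0 x)
  linarith

/-- Borel functions `f` on the bicomplex numbers with `∫ |f(Z)|² exp(-ν |Z|²) dλ(Z) < ∞`. -/
def weightedL2 (ν : ℝ) : Submodule Bicomplex (Bicomplex → Bicomplex) where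
  carrier := {f | Measurable f ∧
    Integrable (fun Z : Bicomplex => Real.exp (-ν * ‖Z‖ ^ 2) * ‖f Z‖ ^ 2)}
  add_mem' {f g} hf hg := ⟨hf.1.add hg.1,
    integrable_add (by fun_prop) (fun _ => (Real.exp_pos _).le)
      hf.1.aestronglyMeasurable hg.1.aestronglyMeasurable hf.2 hg.2⟩
  zero_mem' := ⟨measurable_const, by simp⟩
  smul_mem' c f hf := ⟨hf.1.const_smul c,
    integrable_mul c (by fun_prop) (fun _ => (Real.exp_pos _).le)
      hf.1.aestronglyMeasurable hf.2⟩

/-- The bicomplex Bargmann space. -/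
def bargmannSpace (ν : ℝ) : Submodule Bicomplex (Bicomplex → Bicomplex) :=
  weightedL2 ν ⊓ holomorphicFunctions

/-- `⟨f, g⟩ = (ν/π)² ∫ f(Z) g(Z)* exp(-ν |Z|²) dλ(Z)`. -/
def bargmannInner (ν : ℝ) (f g : Bicomplex → Bicomplex) : Bicomplex :=
  (((ν / Real.pi) ^ 2 : ℝ) : ℂ) •
    ∫ Z : Bicomplex, ((Real.exp (-ν * ‖Z‖ ^ 2) : ℝ) : ℂ) • (f Z * conjStar (g Z))

/-- Classes, modulo equality Lebesgue-almost everywhere, of measurable bicomplex-valued functions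
`φ` on the real line with `∫ |φ(x)|² exp(-σ x²) dx < ∞`. -/
def lineL2 (σ : ℝ) : Submodule Bicomplex (ℝ →ₘ[(volume : Measure ℝ)] Bicomplex) where
  carrier := {φ | Integrable (fun x : ℝ => Real.exp (-σ * x ^ 2) * ‖φ x‖ ^ 2)}
  add_mem' {φ ψ} hφ hψ := by
    refine (integrable_add (by fun_prop) (fun _ => (Real.exp_pos _).le)
      φ.aestronglyMeasurable ψ.aestronglyMeasurable hφ hψ).congr ?_
    filter_upwards [AEEqFun.coeFn_add φ ψ] with x hx
    simp [hx]
  zero_mem' := by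
    refine (integrable_zero ℝ ℝ volume).congr ?_
    filter_upwards [AEEqFun.coeFn_zero (α := ℝ) (β := Bicomplex) (μ := volume)] with x hx
    simp [hx]
  smul_mem' c φ hφ := by
    refine (integrable_mul c (by fun_prop) (fun _ => (Real.exp_pos _).le)
      φ.aestronglyMeasurable hφ).congr ?_
    filter_upwards [AEEqFun.coeFn_smul c φ] with x hx
    simp [hx]

/-- `⟨φ, ψ⟩ = (σ/π)^(1/2) ∫ φ(x) ψ(x)* exp(-σ x²) dx`. -/
def lineInner (σ : ℝ) (φ ψ : ℝ → Bicomplex) : Bicomplex :=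
  ((√(σ / Real.pi) : ℝ) : ℂ) •
    ∫ x : ℝ, ((Real.exp (-σ * x ^ 2) : ℝ) : ℂ) • (φ x * conjStar (ψ x))

/-- The kernel `(σ/π)^(1/2) exp(-σ (x - √(ν/(4σ)) Z)²)`. -/
def segalBargmannKernel (σ ν x : ℝ) (Z : Bicomplex) : Bicomplex :=
  ((√(σ / Real.pi) : ℝ) : ℂ) •
    exp (-((σ : ℂ) • (algebraMap ℂ Bicomplex (x : ℂ) - ((√(ν / (4 * σ)) : ℝ) : ℂ) • Z) ^ 2))

/-- The bicomplex Segal–Bargmann transform. -/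
def segalBargmann (σ ν : ℝ) (φ : ℝ → Bicomplex) (Z : Bicomplex) : Bicomplex :=
  ∫ x : ℝ, segalBargmannKernel σ ν x Z * φ x

/-- The rescaled Hermite polynomial `(-1)ⁿ exp(σ x²) dⁿ/dxⁿ exp(-σ x²)`. -/
def hermitePoly (σ : ℝ) (n : ℕ) (x : ℝ) : ℝ :=
  (-1) ^ n * Real.exp (σ * x ^ 2) * iteratedDeriv n (fun y : ℝ => Real.exp (-σ * y ^ 2)) x

/-- The normalized Hermite function `(2ⁿ σⁿ n!)^(-1/2) Hₙ`, with bicomplex values. -/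
def hermiteFun (σ : ℝ) (n : ℕ) (x : ℝ) : Bicomplex :=
  algebraMap ℂ Bicomplex ((√(1 / (2 ^ n * σ ^ n * n.factorial)) * hermitePoly σ n x : ℝ) : ℂ)

/-- The normalized monomial `(νⁿ / (2ⁿ n!))^(1/2) Zⁿ`. -/
def monomialFun (ν : ℝ) (n : ℕ) (Z : Bicomplex) : Bicomplex :=
  ((√(ν ^ n / (2 ^ n * n.factorial)) : ℝ) : ℂ) • Z ^ n

end Bicomplex

end

noncomputable section

namespace Bicomplex

open Polynomial

/-! The idempotents `ePlus` and `eMinus` identify the bicomplex numbers with `ℂ × ℂ` as an algebra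
through `Z ↦ (α, β)`, and every object in the theorem splits accordingly. The kernel at `Z` has
components the complex kernels at `α` and `β`, so the transform is two copies of a one-variable
transform (`segalBargmann_eq`). Since `|Z|² = (|α|² + |β|²) / 2` and the change of variables has
real Jacobian 4, the normalized Gaussian measure on the bicomplex numbers becomes the product of two
copies of the probability measure with density `ν/(2π) exp(-ν |z|²/2)` (`measurePreserving_parts`).
A bicomplex holomorphic function is exactly `u(α) e₊ + v(β) e₋` with `u` and `v` entire
(`IsHolomorphic.exists_parts`, `isHolomorphic_ofParts`).

In one variable the proof compares orthonormal systems. The Hermite functions form a Hilbert basis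
of the Gaussian `L²` space of the line, the monomials are orthonormal in that of the plane, and the
transform sends one system to the other (`segalBargmannC_hermiteC`). Parseval's identity at a fixed
`z` expands the transform as a power series valid at every point, while the abstract isometry
matching the two systems is given by the same series in `L²`; the two agree almost everywhere
(`hermiteToMonomial_ae_eq`). This gives unitarity and injectivity.

For surjectivity, the scalar product of an entire function with a monomial is a multiple of its
Taylor coefficient. Bessel's inequality makes these products square summable, and the function on
the line with these Hermite coefficients is mapped to the Taylor series
(`exists_segalBargmannC_eq`). -/

/-! ### Hermite polynomials and their Gaussian integrals. -/

/-- The polynomials `Pₙ` with `dⁿ/dxⁿ exp(-σ x²) = (-1)ⁿ Pₙ(x) exp(-σ x²)`. -/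
def scaledHermite (σ : ℝ) : ℕ → ℝ[X]
  | 0 => 1
  | n + 1 => C (2 * σ) * (X * scaledHermite σ n) - derivative (scaledHermite σ n)

theorem natDegree_scaledHermite_le (σ : ℝ) (n : ℕ) : (scaledHermite σ n).natDegree ≤ n := by
  induction n with
  | zero => simp [scaledHermite]
  | succ n ih =>
    rw [scaledHermite]
    refine (natDegree_sub_le _ _).trans (max_le ?_ ?_)
    · refine (natDegree_C_mul_le _ _).trans (natDegree_mul_le.trans ?_)
      have := natDegree_X_le (R := ℝ)
      omega
    · exact (natDegree_derivative_le _).trans (by omega)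

/-- This coefficient supplies the normalization in the orthogonality relations, and its nonvanishing
shows that the polynomials span. -/
theorem coeff_scaledHermite_self (σ : ℝ) (n : ℕ) :
    (scaledHermite σ n).coeff n = (2 * σ) ^ n := by
  induction n with
  | zero => simp [scaledHermite]
  | succ n ih =>
    have h : (scaledHermite σ n).coeff (n + 1 + 1) = 0 :=
      coeff_eq_zero_of_natDegree_lt ((natDegree_scaledHermite_le σ n).trans_lt (by omega))
    rw [scaledHermite, coeff_sub, coeff_C_mul, coeff_X_mul, ih, coeff_derivative, h]
    ring

theorem hasDerivAt_scaledHermite_mul_exp (σ : ℝ) (n : ℕ) (x : ℝ) :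
    HasDerivAt (fun y : ℝ => (scaledHermite σ n).eval y * Real.exp (-σ * y ^ 2))
      (-((scaledHermite σ (n + 1)).eval x * Real.exp (-σ * x ^ 2))) x := by
  have h1 := (scaledHermite σ n).hasDerivAt x
  have h2 : HasDerivAt (fun y : ℝ => Real.exp (-σ * y ^ 2))
      (Real.exp (-σ * x ^ 2) * (-σ * (2 * x))) x := by
    simpa using ((hasDerivAt_pow 2 x).const_mul (-σ)).exp
  refine (h1.mul h2).congr_deriv ?_
  simp only [scaledHermite, eval_sub, eval_mul, eval_C, eval_X]
  ring

theorem iteratedDeriv_exp_neg_mul_sq (σ : ℝ) (n : ℕ) :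
    iteratedDeriv n (fun y : ℝ => Real.exp (-σ * y ^ 2)) =
      fun x => (-1) ^ n * ((scaledHermite σ n).eval x * Real.exp (-σ * x ^ 2)) := by
  induction n with
  | zero => ext x; simp [scaledHermite]
  | succ n ih =>
    ext x
    rw [iteratedDeriv_succ, ih,
      ((hasDerivAt_scaledHermite_mul_exp σ n x).const_mul ((-1) ^ n)).deriv]
    ring

theorem hermitePoly_eq (σ : ℝ) (n : ℕ) (x : ℝ) :
    hermitePoly σ n x = (scaledHermite σ n).eval x := by
  have h : Real.exp (σ * x ^ 2) * Real.exp (-σ * x ^ 2) = 1 := by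
    rw [← Real.exp_add]; simp
  have h' : ((-1 : ℝ) ^ n) * (-1) ^ n = 1 := by rw [← mul_pow]; simp
  rw [hermitePoly, iteratedDeriv_exp_neg_mul_sq]
  calc _ = ((-1 : ℝ) ^ n * (-1) ^ n) * (Real.exp (σ * x ^ 2) * Real.exp (-σ * x ^ 2)) *
        (scaledHermite σ n).eval x := by ring
    _ = _ := by rw [h, h']; ring

theorem integrable_pow_mul_cexp_mul_gaussian {σ : ℝ} (hσ : 0 < σ) (n : ℕ) (c : ℂ) :
    Integrable (fun x : ℝ => (x : ℂ) ^ n * Complex.exp (c * x) * Complex.exp (-σ * x ^ 2)) := by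
  have hi (a : ℝ) : Integrable (fun x : ℝ => Real.exp (-σ * x ^ 2 + a * x)) := by
    have := (integrable_cexp_quadratic (b := σ) (by simpa using hσ) a 0).norm
    refine this.congr (ae_of_all _ fun x => ?_)
    simp [Complex.norm_exp, ← Complex.ofReal_pow]
  refine (((hi (c.re + 1)).add (hi (c.re - 1))).const_mul (n.factorial : ℝ)).mono'
    (by fun_prop) (ae_of_all _ fun x => ?_)
  -- The power is absorbed into exponentials, which only shifts the real part of `c` by ±1 and
  -- leaves a Gaussian with a linear term.
  have h1 : |x| ^ n ≤ n.factorial * (Real.exp x + Real.exp (-x)) := by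
    have h2 := Real.pow_div_factorial_le_exp |x| (abs_nonneg x) n
    rw [div_le_iff₀ (by positivity), mul_comm] at h2
    refine h2.trans (mul_le_mul_of_nonneg_left ?_ (by positivity))
    rcases abs_cases x with h | h <;> rw [h.1] <;> linarith [Real.exp_pos x, Real.exp_pos (-x)]
  have h3 : ‖(x : ℂ) ^ n * Complex.exp (c * x) * Complex.exp (-σ * x ^ 2)‖ =
      |x| ^ n * (Real.exp (c.re * x) * Real.exp (-σ * x ^ 2)) := by
    simp [Complex.norm_exp, ← Complex.ofReal_pow, mul_assoc]
  rw [h3]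
  refine (mul_le_mul_of_nonneg_right h1 (by positivity)).trans (le_of_eq ?_)
  simp only [Pi.add_apply]
  rw [mul_assoc, add_mul, ← Real.exp_add, ← Real.exp_add, ← Real.exp_add]
  ring_nf

theorem integrable_eval_mul_cexp_mul_gaussian {σ : ℝ} (hσ : 0 < σ) (q : ℂ[X]) (c : ℂ) :
    Integrable (fun x : ℝ => q.eval (x : ℂ) * Complex.exp (c * x) * Complex.exp (-σ * x ^ 2)) := by
  induction q using Polynomial.induction_on' with
  | add p q hp hq =>
    refine (hp.add hq).congr (ae_of_all _ fun x => ?_)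
    simp only [Pi.add_apply, eval_add]; ring
  | monomial n a =>
    refine ((integrable_pow_mul_cexp_mul_gaussian hσ n c).const_mul a).congr
      (ae_of_all _ fun x => ?_)
    simp only [eval_monomial]; ring

/-- The complex-coefficient version of `scaledHermite`. -/
def complexHermite (σ : ℝ) (n : ℕ) : ℂ[X] := (scaledHermite σ n).map Complex.ofRealHom

theorem eval_complexHermite (σ : ℝ) (n : ℕ) (x : ℝ) :
    (complexHermite σ n).eval (x : ℂ) = (((scaledHermite σ n).eval x : ℝ) : ℂ) := by
  rw [complexHermite]
  exact Polynomial.eval_map_apply Complex.ofRealHom x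

theorem hasDerivAt_complexHermite_mul_cexp (σ : ℝ) (n : ℕ) (x : ℝ) :
    HasDerivAt (fun y : ℝ => (complexHermite σ n).eval (y : ℂ) * Complex.exp (-σ * y ^ 2))
      (-((complexHermite σ (n + 1)).eval (x : ℂ) * Complex.exp (-σ * x ^ 2))) x := by
  have h := (hasDerivAt_scaledHermite_mul_exp σ n x).ofReal_comp
  simp only [Complex.ofReal_mul, Complex.ofReal_neg, ← eval_complexHermite, Complex.ofReal_exp,
    Complex.ofReal_pow] at h
  exact h

/-- Integration by parts lowers the Hermite index by one and applies `q ↦ q' + c q` to the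
polynomial in front of `exp (c x)`. The case `q = 1` yields the transform of the Hermite functions;
the case `c = 0` yields their orthogonality. -/
theorem integral_mul_complexHermite_succ {σ : ℝ} (hσ : 0 < σ) (q : ℂ[X]) (c : ℂ) (n : ℕ) :
    ∫ x : ℝ, q.eval (x : ℂ) * Complex.exp (c * x) *
        ((complexHermite σ (n + 1)).eval (x : ℂ) * Complex.exp (-σ * x ^ 2)) =
      ∫ x : ℝ, (derivative q + C c * q).eval (x : ℂ) * Complex.exp (c * x) *
        ((complexHermite σ n).eval (x : ℂ) * Complex.exp (-σ * x ^ 2)) := by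
  have hint (q p : ℂ[X]) : Integrable (fun x : ℝ => q.eval (x : ℂ) * Complex.exp (c * x) *
      (p.eval (x : ℂ) * Complex.exp (-σ * x ^ 2))) := by
    refine (integrable_eval_mul_cexp_mul_gaussian hσ (q * p) c).congr (ae_of_all _ fun x => ?_)
    simp only [eval_mul]; ring
  have hu (x : ℝ) : HasDerivAt (fun y : ℝ => q.eval (y : ℂ) * Complex.exp (c * y))
      ((derivative q + C c * q).eval (x : ℂ) * Complex.exp (c * x)) x := by
    have h1 := (q.hasDerivAt (x : ℂ)).comp_ofReal
    have h2 : HasDerivAt (fun y : ℝ => Complex.exp (c * y)) (Complex.exp (c * x) * c) x := by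
      simpa using (((hasDerivAt_id (x : ℂ)).const_mul c).cexp).comp_ofReal
    refine (h1.mul h2).congr_deriv ?_
    simp only [eval_add, eval_mul, eval_C]; ring
  have h := integral_mul_deriv_eq_deriv_mul_of_integrable (fun x _ => hu x)
    (fun x _ => hasDerivAt_complexHermite_mul_cexp σ n x)
    (by
      refine (hint q (complexHermite σ (n + 1))).neg.congr (ae_of_all _ fun x => ?_)
      simp only [Pi.mul_apply, Pi.neg_apply]; ring) (hint _ _) (hint _ _)
  rw [← neg_inj, ← h, ← integral_neg]
  congr 1
  ext x
  ring

theorem integral_mul_complexHermite {σ : ℝ} (hσ : 0 < σ) (c : ℂ) (n : ℕ) (q : ℂ[X]) :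
    ∫ x : ℝ, q.eval (x : ℂ) * Complex.exp (c * x) *
        ((complexHermite σ n).eval (x : ℂ) * Complex.exp (-σ * x ^ 2)) =
      ∫ x : ℝ, ((fun p => derivative p + C c * p)^[n] q).eval (x : ℂ) * Complex.exp (c * x) *
        Complex.exp (-σ * x ^ 2) := by
  induction n generalizing q with
  | zero => simp [complexHermite, scaledHermite]
  | succ n ih => rw [integral_mul_complexHermite_succ hσ, ih]; rfl

theorem integral_cexp_mul_gaussian {σ : ℝ} (hσ : 0 < σ) (c : ℂ) :
    ∫ x : ℝ, Complex.exp (c * x) * Complex.exp (-σ * x ^ 2) =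
      (√(Real.pi / σ) : ℝ) * Complex.exp (c ^ 2 / (4 * σ)) := by
  have h := integral_cexp_quadratic (b := -(σ : ℂ)) (by simpa using hσ) c 0
  have h2 : ((Real.pi : ℂ) / - -(σ : ℂ)) ^ (1 / 2 : ℂ) = (√(Real.pi / σ) : ℝ) := by
    rw [neg_neg, Real.sqrt_eq_rpow, Complex.ofReal_cpow (by positivity)]
    push_cast
    rfl
  rw [h2] at h
  convert h using 2
  · ext x; rw [← Complex.exp_add]; ring_nf
  · congr 1; ring

theorem integral_cexp_mul_complexHermite {σ : ℝ} (hσ : 0 < σ) (c : ℂ) (n : ℕ) :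
    ∫ x : ℝ, Complex.exp (c * x) *
        ((complexHermite σ n).eval (x : ℂ) * Complex.exp (-σ * x ^ 2)) =
      c ^ n * ((√(Real.pi / σ) : ℝ) * Complex.exp (c ^ 2 / (4 * σ))) := by
  have h := integral_mul_complexHermite hσ c n 1
  have h2 : (fun p : ℂ[X] => derivative p + C c * p)^[n] 1 = C (c ^ n) := by
    induction n with
    | zero => simp
    | succ n ih =>
      rw [Function.iterate_succ_apply', ih (integral_mul_complexHermite hσ c n 1)]
      simp [pow_succ']
  rw [h2] at h
  simp only [eval_one, one_mul, eval_C] at h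
  rw [h, ← integral_cexp_mul_gaussian hσ, ← integral_const_mul]
  congr 1
  ext x
  ring

/-- With `c = 0`, all `n` derivatives fall on a polynomial of degree at most `m`. They kill it if `m
< n`, and leave `n!` times the leading coefficient if `m = n`. -/
theorem integral_complexHermite_mul_of_le {σ : ℝ} (hσ : 0 < σ) {m n : ℕ} (hmn : m ≤ n) :
    ∫ x : ℝ, (complexHermite σ m).eval (x : ℂ) *
        ((complexHermite σ n).eval (x : ℂ) * Complex.exp (-σ * x ^ 2)) =
      if m = n then n.factorial * (2 * σ) ^ n * (√(Real.pi / σ) : ℝ) else 0 := by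
  have h := integral_mul_complexHermite hσ 0 n (complexHermite σ m)
  have hd : (complexHermite σ m).natDegree ≤ m :=
    natDegree_map_le.trans (natDegree_scaledHermite_le σ m)
  have h2 : (fun p : ℂ[X] => derivative p + C 0 * p)^[n] (complexHermite σ m) =
      C (if m = n then (n.factorial * (2 * σ) ^ n : ℂ) else 0) := by
    have : (fun p : ℂ[X] => derivative p + C 0 * p) = derivative := by ext p; simp
    rw [this]
    split_ifs with hmn'
    · subst hmn'
      rw [eq_C_of_natDegree_le_zero ((natDegree_iterate_derivative _ _).trans
        (Nat.sub_eq_zero_of_le hd).le), coeff_iterate_derivative]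
      simp [complexHermite, coeff_scaledHermite_self, Nat.descFactorial_self]
    · rw [iterate_derivative_eq_zero (by omega)]
      simp
  rw [h2] at h
  simp only [zero_mul, Complex.exp_zero, mul_one, eval_C] at h
  rw [h, integral_const_mul]
  have h3 := integral_cexp_mul_gaussian hσ 0
  simp only [zero_mul, Complex.exp_zero, one_mul] at h3
  rw [h3]
  split_ifs <;> simp

theorem integral_complexHermite_mul {σ : ℝ} (hσ : 0 < σ) (m n : ℕ) :
    ∫ x : ℝ, (complexHermite σ m).eval (x : ℂ) *
        ((complexHermite σ n).eval (x : ℂ) * Complex.exp (-σ * x ^ 2)) =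
      if m = n then n.factorial * (2 * σ) ^ n * (√(Real.pi / σ) : ℝ) else 0 := by
  rcases le_total m n with h | h
  · exact integral_complexHermite_mul_of_le hσ h
  · rw [show (∫ x : ℝ, (complexHermite σ m).eval (x : ℂ) *
        ((complexHermite σ n).eval (x : ℂ) * Complex.exp (-σ * x ^ 2))) =
        ∫ x : ℝ, (complexHermite σ n).eval (x : ℂ) *
        ((complexHermite σ m).eval (x : ℂ) * Complex.exp (-σ * x ^ 2)) by
          congr 1; ext x; ring, integral_complexHermite_mul_of_le hσ h]
    by_cases hmn : n = m
    · subst hmn; simp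
    · simp [hmn, Ne.symm hmn]

/-! ### Injectivity of the Fourier transform on integrable functions. -/

/-- An integrable function on the line whose Fourier transform vanishes is zero almost
everywhere. -/
theorem ae_eq_zero_of_fourier_eq_zero {f : ℝ → ℂ} (hf : Integrable f)
    (h : ∀ ξ : ℝ, ∫ x : ℝ, Complex.exp ((ξ * x : ℝ) * Complex.I) * f x = 0) :
    ∀ᵐ x : ℝ, f x = 0 := by
  refine ae_eq_zero_of_integral_contDiff_smul_eq_zero hf.locallyIntegrable fun g hg hgc => ?_
  let g' : SchwartzMap ℝ ℂ := HasCompactSupport.toSchwartzMap (f := fun x => (g x : ℂ))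
    (hgc.comp_left Complex.ofReal_zero) (Complex.ofRealCLM.contDiff.comp hg)
  -- The test function is the Fourier transform of a Schwartz function `u`, so the pairing of `f`
  -- with it equals the pairing of `u` with the transform of `f`, which vanishes.
  obtain ⟨u, hu⟩ : ∃ u : SchwartzMap ℝ ℂ, FourierTransform.fourier u = g' :=
    ⟨FourierTransformInv.fourierInv g', by simp⟩
  have hflip := VectorFourier.integral_fourierIntegral_smul_eq_flip (e := Real.fourierChar)
    (L := innerₗ ℝ) (μ := volume) (ν := volume) Real.continuous_fourierChar
    (by fun_prop) hf u.integrable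
  have hz (ξ : ℝ) : VectorFourier.fourierIntegral Real.fourierChar volume (innerₗ ℝ) f ξ = 0 := by
    have := h (-2 * Real.pi * ξ)
    rw [← this]
    change FourierTransform.fourier f ξ = _
    rw [Real.fourier_eq']
    congr 1
    ext x
    rw [smul_eq_mul]
    congr 4
    simp
    ring
  simp only [hz, zero_smul, integral_zero] at hflip
  rw [hflip]
  congr 1
  ext x
  have hx : g' x = VectorFourier.fourierIntegral Real.fourierChar volume (innerₗ ℝ) u x := by
    rw [← hu, SchwartzMap.fourier_coe]
    rfl
  rw [flip_innerₗ, ← hx, smul_eq_mul, mul_comm]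
  rfl

/-! ### Measures with a positive density. -/

/-- The measure with density `w` with respect to the volume. -/
def weightedMeasure {X : Type*} [MeasureSpace X] (w : X → ℝ) : Measure X :=
  volume.withDensity fun x => ENNReal.ofReal (w x)

section weightedMeasure

variable {X E : Type*} [MeasureSpace X] {w : X → ℝ} [NormedAddCommGroup E]

theorem integral_weightedMeasure [NormedSpace ℝ E] (hw : Measurable w) (hw0 : ∀ x, 0 < w x)
    (f : X → E) : ∫ x, f x ∂(weightedMeasure w) = ∫ x, w x • f x := by
  rw [weightedMeasure, integral_withDensity_eq_integral_toReal_smul hw.ennreal_ofReal (by simp)]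
  simp [ENNReal.toReal_ofReal (hw0 _).le]

theorem integrable_weightedMeasure_iff [NormedSpace ℝ E] (hw : Measurable w)
    (hw0 : ∀ x, 0 < w x) {f : X → E} :
    Integrable f (weightedMeasure w) ↔ Integrable (fun x => w x • f x) := by
  rw [weightedMeasure, integrable_withDensity_iff_integrable_smul' hw.ennreal_ofReal (by simp)]
  simp [ENNReal.toReal_ofReal (hw0 _).le]

theorem ae_weightedMeasure (hw : Measurable w) (hw0 : ∀ x, 0 < w x) :
    ae (weightedMeasure w) = ae (volume : Measure X) :=
  le_antisymm (withDensity_absolutelyContinuous _ _).ae_le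
    (withDensity_absolutelyContinuous' hw.ennreal_ofReal.aemeasurable
      (ae_of_all _ fun x => by simpa using hw0 x)).ae_le

theorem memLp_two_weightedMeasure_iff (hw : Measurable w) (hw0 : ∀ x, 0 < w x) {f : X → E}
    (hf : AEStronglyMeasurable f) :
    MemLp f 2 (weightedMeasure w) ↔ Integrable (fun x => w x * ‖f x‖ ^ 2) := by
  have hf' : AEStronglyMeasurable f (weightedMeasure w) :=
    hf.mono_ac (withDensity_absolutelyContinuous _ _)
  rw [memLp_two_iff_integrable_sq_norm hf', integrable_weightedMeasure_iff hw hw0]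
  simp only [smul_eq_mul]

end weightedMeasure

/-- The Gaussian weight `(σ/π)^(1/2) exp(-σ x²)` on the line. -/
def lineWeight (σ x : ℝ) : ℝ := √(σ / Real.pi) * Real.exp (-σ * x ^ 2)

/-- The Gaussian weight `ν/(2π) exp(-ν |z|²/2)` on the plane. -/
def planeWeight (ν : ℝ) (z : ℂ) : ℝ := ν / (2 * Real.pi) * Real.exp (-(ν / 2) * ‖z‖ ^ 2)

theorem measurable_lineWeight (σ : ℝ) : Measurable (lineWeight σ) := by
  unfold lineWeight; fun_prop

theorem lineWeight_pos {σ : ℝ} (hσ : 0 < σ) (x : ℝ) : 0 < lineWeight σ x := by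
  have := Real.pi_pos
  unfold lineWeight; positivity

theorem continuous_planeWeight (ν : ℝ) : Continuous (planeWeight ν) := by
  unfold planeWeight; fun_prop

theorem planeWeight_pos {ν : ℝ} (hν : 0 < ν) (z : ℂ) : 0 < planeWeight ν z := by
  have := Real.pi_pos
  unfold planeWeight; positivity

/-! ### Integrals of entire functions against conjugate powers. -/

/-- Cauchy's formula for the `n`-th Taylor coefficient, written in the angular variable. -/
theorem integral_circle_mul_exp {f : ℂ → ℂ} (hf : Differentiable ℂ f) {r : ℝ} (hr : 0 < r)
    (n : ℕ) :
    ∫ θ in Set.Ioo (-Real.pi) Real.pi,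
        f (r * Complex.exp (θ * Complex.I)) * Complex.exp (-(n * θ * Complex.I)) =
      2 * Real.pi * r ^ n * (iteratedDeriv n f 0 / n.factorial) := by
  set F : ℝ → ℂ := fun θ => f (r * Complex.exp (θ * Complex.I)) *
    Complex.exp (-(n * θ * Complex.I)) with hF
  have hper : Function.Periodic F (2 * Real.pi) := by
    intro θ
    have h1 : Complex.exp (((θ + 2 * Real.pi : ℝ) : ℂ) * Complex.I) =
        Complex.exp (θ * Complex.I) := by
      push_cast
      rw [add_mul, Complex.exp_periodic]
    have h2 (φ : ℝ) : Complex.exp (-(n * φ * Complex.I)) =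
        (Complex.exp (φ * Complex.I) ^ n)⁻¹ := by
      rw [← Complex.exp_nat_mul, ← Complex.exp_neg]; ring_nf
    simp only [hF, h1, h2]
  have h := hf.differentiableOn.circleIntegral_one_div_sub_center_pow_smul (c := 0) hr n
  rw [← integral_Ioc_eq_integral_Ioo, ← intervalIntegral.integral_of_le (by linarith [Real.pi_pos])]
  -- Polar coordinates use the angles `(-π, π)`, the circle integral `[0, 2π]`; periodicity
  -- identifies the two.
  have h3 := hper.intervalIntegral_add_eq (-Real.pi) 0
  rw [show -Real.pi + 2 * Real.pi = Real.pi by ring, zero_add] at h3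
  rw [h3]
  rw [circleIntegral] at h
  have h4 (θ : ℝ) : deriv (circleMap 0 r) θ •
      (1 / (circleMap 0 r θ - 0) ^ (n + 1)) • f (circleMap 0 r θ) =
      (Complex.I / r ^ n) * F θ := by
    have hr' : (r : ℂ) ≠ 0 := by exact_mod_cast hr.ne'
    have he : Complex.exp (θ * Complex.I) ≠ 0 := Complex.exp_ne_zero _
    have h2 : Complex.exp (-(n * θ * Complex.I)) = (Complex.exp (θ * Complex.I) ^ n)⁻¹ := by
      rw [← Complex.exp_nat_mul, ← Complex.exp_neg]; ring_nf
    simp only [hF, deriv_circleMap, circleMap_zero, smul_eq_mul, sub_zero, h2]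
    field_simp
    ring
  simp_rw [h4] at h
  rw [intervalIntegral.integral_const_mul] at h
  have hr' : (r : ℂ) ≠ 0 := by exact_mod_cast hr.ne'
  have hn : (n.factorial : ℂ) ≠ 0 := by exact_mod_cast n.factorial_ne_zero
  have := Complex.I_ne_zero
  rw [smul_eq_mul] at h
  field_simp at h ⊢
  rw [h]

theorem integral_pow_mul_exp_neg_mul_sq {b : ℝ} (hb : 0 < b) (n : ℕ) :
    ∫ r in Set.Ioi (0 : ℝ), r ^ (2 * n + 1) * Real.exp (-b * r ^ 2) =
      n.factorial / (2 * b ^ (n + 1)) := by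
  have h := integral_rpow_mul_exp_neg_mul_rpow (p := 2) (q := (2 * n + 1 : ℕ)) (b := b)
    (by norm_num) (by have : (0 : ℝ) ≤ (2 * n + 1 : ℕ) := by positivity
                      linarith) hb
  simp only [Real.rpow_natCast, Real.rpow_two] at h
  have h1 : (((2 * n + 1 : ℕ) : ℝ) + 1) / 2 = n + 1 := by push_cast; ring
  rw [h, neg_div, h1, Real.Gamma_nat_eq_factorial, Real.rpow_neg hb.le]
  rw [show (n : ℝ) + 1 = ((n + 1 : ℕ) : ℝ) by push_cast; rfl, Real.rpow_natCast]
  field_simp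

/-- This justifies Fubini's theorem in polar coordinates. -/
theorem integrableOn_polarCoord {F : ℂ → ℂ} (hF : Continuous F) (hi : Integrable F) :
    IntegrableOn (fun p : ℝ × ℝ => p.1 • F (Complex.polarCoord.symm p)) polarCoord.target := by
  have hc : Continuous (fun p : ℝ × ℝ => p.1 • F (Complex.polarCoord.symm p)) := by
    have : (fun p : ℝ × ℝ => p.1 • F (Complex.polarCoord.symm p)) = fun p : ℝ × ℝ =>
        p.1 • F (p.1 * (Real.cos p.2 + Real.sin p.2 * Complex.I)) := by
      ext p; rw [Complex.polarCoord_symm_apply]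
    rw [this]; fun_prop
  refine ⟨hc.aestronglyMeasurable, ?_⟩
  have h := Complex.lintegral_comp_polarCoord_symm (fun z => ‖F z‖ₑ)
  rw [HasFiniteIntegral, show (∫⁻ p in polarCoord.target,
    ‖p.1 • F (Complex.polarCoord.symm p)‖ₑ) = ∫⁻ z, ‖F z‖ₑ from ?_]
  · exact hi.2
  · rw [← h]
    refine setLIntegral_congr_fun polarCoord.open_target.measurableSet fun p hp => ?_
    have hp' : 0 < p.1 := by simpa [polarCoord] using hp.1
    simp only [enorm_smul, smul_eq_mul]
    rw [Real.enorm_of_nonneg hp'.le]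

/-- Integrating over the angle first extracts the `n`-th Taylor coefficient on each circle, so no
series has to be exchanged with the integral. In the remaining radial integral, the exponent `2 * n
+ 1` collects `n` from the conjugate power, `n` from the Taylor term and 1 from the Jacobian. -/
theorem integral_conj_pow_mul_planeWeight {ν : ℝ} (hν : 0 < ν) {f : ℂ → ℂ}
    (hf : Differentiable ℂ f) (n : ℕ)
    (hi : Integrable (fun z => planeWeight ν z • (f z * starRingEnd ℂ z ^ n))) :
    ∫ z, planeWeight ν z • (f z * starRingEnd ℂ z ^ n) =
      (2 / ν) ^ n * iteratedDeriv n f 0 := by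
  have hpi := Real.pi_pos
  have hc : Continuous (fun z => planeWeight ν z • (f z * starRingEnd ℂ z ^ n)) := by
    have := hf.continuous
    have := continuous_planeWeight ν
    fun_prop
  have hI := integrableOn_polarCoord hc hi
  rw [← Complex.integral_comp_polarCoord_symm]
  rw [polarCoord_target] at hI ⊢
  rw [Measure.volume_eq_prod, IntegrableOn, ← Measure.prod_restrict] at hI
  rw [Measure.volume_eq_prod, ← Measure.prod_restrict, integral_prod _ hI]
  have hinner (r : ℝ) (hr : r ∈ Set.Ioi (0 : ℝ)) :
      ∫ θ in Set.Ioo (-Real.pi) Real.pi, r • (planeWeight ν (Complex.polarCoord.symm (r, θ)) •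
        (f (Complex.polarCoord.symm (r, θ)) *
          starRingEnd ℂ (Complex.polarCoord.symm (r, θ)) ^ n)) =
      ((r ^ (2 * n + 1) * Real.exp (-(ν / 2) * r ^ 2) : ℝ) : ℂ) *
        (ν * (iteratedDeriv n f 0 / n.factorial)) := by
    have hr0 : 0 < r := hr
    have hpt (θ : ℝ) : r • (planeWeight ν (Complex.polarCoord.symm (r, θ)) •
        (f (Complex.polarCoord.symm (r, θ)) *
          starRingEnd ℂ (Complex.polarCoord.symm (r, θ)) ^ n)) =
        ((r ^ (n + 1) * (ν / (2 * Real.pi)) * Real.exp (-(ν / 2) * r ^ 2) : ℝ) : ℂ) *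
          (f (r * Complex.exp (θ * Complex.I)) * Complex.exp (-(n * θ * Complex.I))) := by
      have h1 : Complex.polarCoord.symm (r, θ) = r * Complex.exp (θ * Complex.I) := by
        rw [Complex.polarCoord_symm_apply, Complex.exp_mul_I]
        simp
      have h2 : starRingEnd ℂ (r * Complex.exp (θ * Complex.I)) ^ n =
          r ^ n * Complex.exp (-(n * θ * Complex.I)) := by
        rw [map_mul, ← Complex.exp_conj, mul_pow, ← Complex.exp_nat_mul]
        simp only [Complex.conj_ofReal, map_mul, Complex.conj_I]
        ring_nf
      rw [planeWeight, Complex.norm_polarCoord_symm, h1, h2]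
      simp only [sq_abs, Complex.real_smul]
      push_cast
      ring
    simp_rw [hpt]
    rw [integral_const_mul, integral_circle_mul_exp hf hr0]
    have : (Real.pi : ℂ) ≠ 0 := by exact_mod_cast hpi.ne'
    push_cast
    field_simp
    ring
  rw [setIntegral_congr_fun measurableSet_Ioi hinner, integral_mul_const, integral_complex_ofReal,
    integral_pow_mul_exp_neg_mul_sq (by positivity)]
  have h1 : (ν : ℂ) ≠ 0 := by exact_mod_cast hν.ne'
  have hn : (n.factorial : ℂ) ≠ 0 := by exact_mod_cast n.factorial_ne_zero
  push_cast
  rw [div_pow, div_pow]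
  field_simp
  ring

/-! ### Hermite functions as a Hilbert basis. -/

/-- The Gaussian measure on the line with density `lineWeight σ`. -/
abbrev lineGauss (σ : ℝ) : Measure ℝ := weightedMeasure (lineWeight σ)

/-- The Gaussian measure on the plane with density `planeWeight ν`. -/
abbrev planeGauss (ν : ℝ) : Measure ℂ := weightedMeasure (planeWeight ν)

theorem inner_toLp_toLp {X : Type*} [MeasurableSpace X] {μ : Measure X} {f g : X → ℂ}
    (hf : MemLp f 2 μ) (hg : MemLp g 2 μ) :
    inner ℂ (hf.toLp f) (hg.toLp g) = ∫ x, g x * starRingEnd ℂ (f x) ∂μ := by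
  rw [L2.inner_def]
  refine integral_congr_ae ?_
  filter_upwards [hf.coeFn_toLp, hg.coeFn_toLp] with x h1 h2
  rw [h1, h2, RCLike.inner_apply]

theorem integral_lineGauss {σ : ℝ} (hσ : 0 < σ) (f : ℝ → ℂ) :
    ∫ x, f x ∂(lineGauss σ) =
      (√(σ / Real.pi) : ℝ) * ∫ x : ℝ, f x * Complex.exp (-σ * x ^ 2) := by
  rw [integral_weightedMeasure (measurable_lineWeight σ) (lineWeight_pos hσ),
    ← integral_const_mul]
  congr 1
  ext x
  rw [lineWeight, Complex.real_smul]
  push_cast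
  ring

theorem memLp_eval_mul_cexp {σ : ℝ} (hσ : 0 < σ) (q : ℂ[X]) (c : ℂ) :
    MemLp (fun x : ℝ => q.eval (x : ℂ) * Complex.exp (c * x)) 2 (lineGauss σ) := by
  rw [memLp_two_weightedMeasure_iff (measurable_lineWeight σ) (lineWeight_pos hσ)
    (by fun_prop)]
  refine ((integrable_eval_mul_cexp_mul_gaussian hσ (q * q) (2 * c)).norm.const_mul
    √(σ / Real.pi)).congr (ae_of_all _ fun x => ?_)
  have h1 : Complex.exp (2 * c * x) = Complex.exp (c * x) * Complex.exp (c * x) := by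
    rw [← Complex.exp_add]; ring_nf
  have h2 : ‖Complex.exp (-σ * x ^ 2)‖ = Real.exp (-σ * x ^ 2) := by
    rw [Complex.norm_exp]; simp [← Complex.ofReal_pow]
  simp only [eval_mul, h1, norm_mul, h2, lineWeight]
  ring

theorem memLp_cexp {σ : ℝ} (hσ : 0 < σ) (c : ℂ) :
    MemLp (fun x : ℝ => Complex.exp (c * x)) 2 (lineGauss σ) := by
  simpa using memLp_eval_mul_cexp hσ 1 c

theorem memLp_eval {σ : ℝ} (hσ : 0 < σ) (q : ℂ[X]) :
    MemLp (fun x : ℝ => q.eval (x : ℂ)) 2 (lineGauss σ) := by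
  simpa using memLp_eval_mul_cexp hσ q 0

/-- The normalized Hermite function with complex values. -/
def hermiteC (σ : ℝ) (n : ℕ) (x : ℝ) : ℂ :=
  ((√(1 / (2 ^ n * σ ^ n * n.factorial)) * hermitePoly σ n x : ℝ) : ℂ)

theorem hermiteC_eq (σ : ℝ) (n : ℕ) (x : ℝ) :
    hermiteC σ n x = (√(1 / (2 ^ n * σ ^ n * n.factorial)) : ℝ) *
      (complexHermite σ n).eval (x : ℂ) := by
  rw [hermiteC, hermitePoly_eq, eval_complexHermite, Complex.ofReal_mul]

theorem conj_hermiteC (σ : ℝ) (n : ℕ) (x : ℝ) :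
    starRingEnd ℂ (hermiteC σ n x) = hermiteC σ n x := Complex.conj_ofReal _

theorem memLp_hermiteC {σ : ℝ} (hσ : 0 < σ) (n : ℕ) :
    MemLp (hermiteC σ n) 2 (lineGauss σ) := by
  have : hermiteC σ n = fun x : ℝ => (√(1 / (2 ^ n * σ ^ n * n.factorial)) : ℝ) *
      (complexHermite σ n).eval (x : ℂ) := funext (hermiteC_eq σ n)
  rw [this]
  exact (memLp_eval hσ _).const_mul _

theorem integral_hermiteC_mul {σ : ℝ} (hσ : 0 < σ) (m n : ℕ) :
    ∫ x, hermiteC σ m x * starRingEnd ℂ (hermiteC σ n x) ∂(lineGauss σ) =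
      if m = n then 1 else 0 := by
  have hpi := Real.pi_pos
  rw [integral_lineGauss hσ]
  have h (x : ℝ) : hermiteC σ m x * starRingEnd ℂ (hermiteC σ n x) *
      Complex.exp (-σ * x ^ 2) =
      ((√(1 / (2 ^ m * σ ^ m * m.factorial)) : ℝ) * (√(1 / (2 ^ n * σ ^ n * n.factorial)) : ℝ)) *
      ((complexHermite σ m).eval (x : ℂ) *
        ((complexHermite σ n).eval (x : ℂ) * Complex.exp (-σ * x ^ 2))) := by
    rw [conj_hermiteC, hermiteC_eq, hermiteC_eq]; ring
  simp_rw [h]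
  rw [integral_const_mul, integral_complexHermite_mul hσ]
  split_ifs with hmn
  · subst hmn
    have h1 : √(σ / Real.pi) * √(Real.pi / σ) = 1 := by
      rw [← Real.sqrt_mul (by positivity)]
      rw [show σ / Real.pi * (Real.pi / σ) = 1 by field_simp, Real.sqrt_one]
    have h2 : √(1 / (2 ^ m * σ ^ m * m.factorial)) * √(1 / (2 ^ m * σ ^ m * m.factorial)) *
        (m.factorial * (2 * σ) ^ m) = 1 := by
      rw [Real.mul_self_sqrt (by positivity), mul_pow]
      field_simp
    calc _ = (((√(σ / Real.pi) * √(Real.pi / σ)) * (√(1 / (2 ^ m * σ ^ m * m.factorial)) *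
          √(1 / (2 ^ m * σ ^ m * m.factorial)) * (m.factorial * (2 * σ) ^ m)) : ℝ) : ℂ) := by
            push_cast; ring
      _ = 1 := by rw [h1, h2]; simp
  · simp

/-- The Hermite functions as elements of `L²`. -/
def hermiteLp {σ : ℝ} (hσ : 0 < σ) (n : ℕ) : Lp ℂ 2 (lineGauss σ) :=
  (memLp_hermiteC hσ n).toLp (hermiteC σ n)

theorem orthonormal_hermiteLp {σ : ℝ} (hσ : 0 < σ) : Orthonormal ℂ (hermiteLp hσ) := by
  classical
  rw [orthonormal_iff_ite]
  intro m n
  rw [hermiteLp, hermiteLp, inner_toLp_toLp, integral_hermiteC_mul hσ]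
  simp [eq_comm]

/-- There is exactly one polynomial of each degree, and its leading coefficient is a unit. -/
theorem span_complexHermite {σ : ℝ} (hσ : 0 < σ) :
    Submodule.span ℂ (Set.range (complexHermite σ)) = ⊤ := by
  have hcoeff (n : ℕ) : (complexHermite σ n).coeff n ≠ 0 := by
    rw [complexHermite, coeff_map, coeff_scaledHermite_self]
    simpa using fun h => absurd h hσ.ne'
  have hnat (n : ℕ) : (complexHermite σ n).natDegree = n :=
    le_antisymm (natDegree_map_le.trans (natDegree_scaledHermite_le σ n))
      (le_natDegree_of_ne_zero (hcoeff n))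
  have hne (n : ℕ) : complexHermite σ n ≠ 0 := fun h => hcoeff n (by rw [h, coeff_zero])
  let S : Polynomial.Sequence ℂ := ⟨complexHermite σ, fun n => by
    rw [degree_eq_natDegree (hne n), hnat]⟩
  exact S.span fun n => isUnit_iff_ne_zero.mpr (leadingCoeff_ne_zero.mpr (hne n))

theorem integral_eval_mul_eq_zero {σ : ℝ} (hσ : 0 < σ) {φ : ℝ → ℂ}
    (hφ : MemLp φ 2 (lineGauss σ))
    (h : ∀ n, ∫ x, φ x * starRingEnd ℂ (hermiteC σ n x) ∂(lineGauss σ) = 0) (q : ℂ[X]) :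
    ∫ x, q.eval (x : ℂ) * φ x ∂(lineGauss σ) = 0 := by
  have hq : q ∈ Submodule.span ℂ (Set.range (complexHermite σ)) := by
    rw [span_complexHermite hσ]; trivial
  have hint (p : ℂ[X]) : Integrable (fun x : ℝ => p.eval (x : ℂ) * φ x) (lineGauss σ) :=
    (memLp_eval hσ p).integrable_mul hφ
  induction hq using Submodule.span_induction with
  | mem p hp =>
    obtain ⟨n, rfl⟩ := hp
    have h1 := h n
    simp_rw [conj_hermiteC, hermiteC_eq] at h1
    have h2 : (fun x : ℝ => φ x * ((√(1 / (2 ^ n * σ ^ n * n.factorial)) : ℝ) *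
        (complexHermite σ n).eval (x : ℂ))) = fun x : ℝ =>
        ((√(1 / (2 ^ n * σ ^ n * n.factorial)) : ℝ) : ℂ) *
          ((complexHermite σ n).eval (x : ℂ) * φ x) := by ext x; ring
    rw [h2, integral_const_mul, mul_eq_zero] at h1
    refine h1.resolve_left ?_
    exact_mod_cast (Real.sqrt_pos.mpr (by positivity)).ne'
  | zero => simp
  | add p q _ _ hp hq =>
    simp only [eval_add, add_mul]
    rw [integral_add (hint p) (hint q), hp, hq, add_zero]
  | smul a p _ hp =>
    simp only [eval_smul, smul_eq_mul, mul_assoc]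
    rw [integral_const_mul, hp, mul_zero]

/-- The exponential is expanded in powers of `x`, each of which is orthogonal to `φ`. Partial sums
are dominated by `exp |ξ x| * ‖φ x‖`, integrable because real exponentials lie in the Gaussian `L²`
space. -/
theorem integral_cexp_I_mul_eq_zero {σ : ℝ} (hσ : 0 < σ) {φ : ℝ → ℂ}
    (hφ : MemLp φ 2 (lineGauss σ))
    (h : ∀ n, ∫ x, φ x * starRingEnd ℂ (hermiteC σ n x) ∂(lineGauss σ) = 0) (ξ : ℝ) :
    ∫ x : ℝ, Complex.exp ((ξ * x : ℝ) * Complex.I) * φ x ∂(lineGauss σ) = 0 := by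
  have hbound : Integrable (fun x : ℝ => Real.exp |ξ * x| * ‖φ x‖) (lineGauss σ) := by
    have hi (a : ℝ) : Integrable (fun x : ℝ => Real.exp (a * x) * ‖φ x‖) (lineGauss σ) := by
      refine ((memLp_cexp hσ a).integrable_mul hφ).norm.congr (ae_of_all _ fun x => ?_)
      simp [Complex.norm_exp]
    refine ((hi ξ).add (hi (-ξ))).mono' ?_ (ae_of_all _ fun x => ?_)
    · exact (Continuous.aestronglyMeasurable (by fun_prop)).mul hφ.1.norm
    · rw [Real.norm_of_nonneg (by positivity), Pi.add_apply, ← add_mul]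
      refine mul_le_mul_of_nonneg_right ?_ (norm_nonneg _)
      rcases abs_cases (ξ * x) with h | h <;> rw [h.1]
      · linarith [Real.exp_pos (-ξ * x)]
      · rw [← neg_mul]; linarith [Real.exp_pos (ξ * x)]
  have hexp (y : ℝ) : HasSum (fun n : ℕ => y ^ n / n.factorial) (Real.exp y) := by
    rw [Real.exp_eq_exp_ℝ]
    exact NormedSpace.expSeries_div_hasSum_exp y
  have hsum := hasSum_integral_of_dominated_convergence (μ := lineGauss σ)
    (F := fun (n : ℕ) (x : ℝ) => (((ξ * x : ℝ) * Complex.I) ^ n / n.factorial) * φ x)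
    (f := fun x => Complex.exp ((ξ * x : ℝ) * Complex.I) * φ x)
    (fun n x => |ξ * x| ^ n / n.factorial * ‖φ x‖)
    (fun n => (Continuous.aestronglyMeasurable (by fun_prop)).mul hφ.1)
    (fun n => ae_of_all _ fun x => by
      rw [norm_mul, norm_div, norm_pow, norm_mul, Complex.norm_I, mul_one, Complex.norm_real,
        Real.norm_eq_abs, Complex.norm_natCast])
    (ae_of_all _ fun x => (hexp |ξ * x|).summable.mul_right _)
    (by
      refine hbound.congr (ae_of_all _ fun x => ?_)
      exact ((hexp |ξ * x|).mul_right ‖φ x‖).tsum_eq.symm)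
    (ae_of_all _ fun x => by
      refine HasSum.mul_right _ ?_
      rw [Complex.exp_eq_exp_ℂ]
      exact NormedSpace.expSeries_div_hasSum_exp _)
  have hzero (n : ℕ) :
      ∫ x : ℝ, (((ξ * x : ℝ) * Complex.I) ^ n / n.factorial) * φ x ∂(lineGauss σ) = 0 := by
    rw [← integral_eval_mul_eq_zero hσ hφ h (C ((ξ * Complex.I) ^ n / n.factorial) * X ^ n)]
    congr 1
    ext x
    simp only [eval_mul, eval_C, eval_pow, eval_X]
    push_cast
    ring
  simp only [hzero] at hsum
  exact hsum.unique hasSum_zero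

/-- Completeness: the product of `φ` and the weight is integrable with zero Fourier transform, and
the weight never vanishes. -/
theorem ae_eq_zero_of_forall_integral_hermiteC {σ : ℝ} (hσ : 0 < σ) {φ : ℝ → ℂ}
    (hφ : MemLp φ 2 (lineGauss σ))
    (h : ∀ n, ∫ x, φ x * starRingEnd ℂ (hermiteC σ n x) ∂(lineGauss σ) = 0) :
    φ =ᵐ[lineGauss σ] 0 := by
  have hm := measurable_lineWeight σ
  have hp := lineWeight_pos hσ
  have hint : Integrable φ (lineGauss σ) := by
    simpa [Pi.mul_def] using (memLp_cexp hσ 0).integrable_mul hφ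
  have h0 := ae_eq_zero_of_fourier_eq_zero ((integrable_weightedMeasure_iff hm hp).mp hint)
    fun ξ => by
      rw [← integral_cexp_I_mul_eq_zero hσ hφ h ξ, integral_weightedMeasure hm hp]
      congr 1
      ext x
      rw [mul_smul_comm]
  rw [EventuallyEq, ae_weightedMeasure hm hp]
  filter_upwards [h0] with x hx
  exact (smul_eq_zero.mp hx).resolve_left (hp x).ne'

/-- The Hermite functions form a Hilbert basis. -/
def hermiteBasis {σ : ℝ} (hσ : 0 < σ) : HilbertBasis ℕ ℂ (Lp ℂ 2 (lineGauss σ)) :=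
  HilbertBasis.mkOfOrthogonalEqBot (orthonormal_hermiteLp hσ) (by
    rw [eq_bot_iff]
    intro φ hφ
    have h (n : ℕ) : ∫ x, φ x * starRingEnd ℂ (hermiteC σ n x) ∂(lineGauss σ) = 0 := by
      rw [← inner_toLp_toLp (memLp_hermiteC hσ n) (Lp.memLp φ), Lp.toLp_coeFn]
      exact (Submodule.mem_orthogonal _ _).mp hφ _ (Submodule.subset_span ⟨n, rfl⟩)
    rw [Submodule.mem_bot]
    exact (Lp.eq_zero_iff_ae_eq_zero).mpr
      (ae_eq_zero_of_forall_integral_hermiteC hσ (Lp.memLp φ) h))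

theorem coe_hermiteBasis {σ : ℝ} (hσ : 0 < σ) : ⇑(hermiteBasis hσ) = hermiteLp hσ :=
  HilbertBasis.coe_mkOfOrthogonalEqBot _ _

/-! ### The one-variable transform as a power series. -/

/-- The normalized monomial on the plane. -/
def monomialC (ν : ℝ) (n : ℕ) (z : ℂ) : ℂ := (√(ν ^ n / (2 ^ n * n.factorial)) : ℝ) * z ^ n

/-- The Segal–Bargmann kernel on the plane. -/
def kernelC (σ ν x : ℝ) (z : ℂ) : ℂ :=
  (√(σ / Real.pi) : ℝ) * Complex.exp (-(σ * (x - (√(ν / (4 * σ)) : ℝ) * z) ^ 2))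

/-- The Segal–Bargmann transform with values in the functions on the plane. -/
def segalBargmannC (σ ν : ℝ) (φ : ℝ → ℂ) (z : ℂ) : ℂ := ∫ x : ℝ, kernelC σ ν x z * φ x

/-- The quotient of the Segal–Bargmann kernel by the Gaussian weight. -/
def expKernel (σ ν : ℝ) (z : ℂ) (x : ℝ) : ℂ :=
  Complex.exp (-(σ * ((√(ν / (4 * σ)) : ℝ) * z) ^ 2)) *
    Complex.exp (2 * σ * ((√(ν / (4 * σ)) : ℝ) * z) * x)

/-- Once the weight is split off, the rest of the kernel lies in the Gaussian `L²` space, and the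
transform at `z` becomes a scalar product there. -/
theorem kernelC_eq (σ ν x : ℝ) (z : ℂ) :
    kernelC σ ν x z = lineWeight σ x • expKernel σ ν z x := by
  rw [kernelC, lineWeight, expKernel, Complex.real_smul, Complex.ofReal_mul, Complex.ofReal_exp,
    mul_assoc, ← Complex.exp_add, ← Complex.exp_add]
  congr 2
  push_cast
  ring

theorem memLp_expKernel {σ : ℝ} (hσ : 0 < σ) (ν : ℝ) (z : ℂ) :
    MemLp (expKernel σ ν z) 2 (lineGauss σ) :=
  (memLp_cexp hσ _).const_mul _

theorem integrable_kernelC_mul {σ : ℝ} (hσ : 0 < σ) (ν : ℝ) {φ : ℝ → ℂ}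
    (hφ : MemLp φ 2 (lineGauss σ)) (z : ℂ) : Integrable (fun x : ℝ => kernelC σ ν x z * φ x) := by
  have h := (integrable_weightedMeasure_iff (measurable_lineWeight σ) (lineWeight_pos hσ)).mp
    ((memLp_expKernel hσ ν z).integrable_mul hφ)
  refine h.congr (ae_of_all _ fun x => ?_)
  simp only [kernelC_eq, Pi.mul_apply, smul_mul_assoc]

theorem segalBargmannC_eq {σ : ℝ} (hσ : 0 < σ) (ν : ℝ) (φ : ℝ → ℂ) (z : ℂ) :
    segalBargmannC σ ν φ z = ∫ x, expKernel σ ν z x * φ x ∂(lineGauss σ) := by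
  rw [integral_weightedMeasure (measurable_lineWeight σ) (lineWeight_pos hσ), segalBargmannC]
  simp only [kernelC_eq, smul_mul_assoc]

theorem segalBargmannC_hermiteC {σ ν : ℝ} (hσ : 0 < σ) (hν : 0 < ν) (n : ℕ) (z : ℂ) :
    segalBargmannC σ ν (hermiteC σ n) z = monomialC ν n z := by
  have hpi := Real.pi_pos
  rw [segalBargmannC_eq hσ, integral_lineGauss hσ]
  set t : ℝ := √(ν / (4 * σ)) with ht
  set k : ℝ := √(1 / (2 ^ n * σ ^ n * n.factorial)) with hk
  have h (x : ℝ) : expKernel σ ν z x * hermiteC σ n x * Complex.exp (-σ * x ^ 2) =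
      (Complex.exp (-(σ * (t * z) ^ 2)) * k) * (Complex.exp (2 * σ * (t * z) * x) *
        ((complexHermite σ n).eval (x : ℂ) * Complex.exp (-σ * x ^ 2))) := by
    rw [expKernel, hermiteC_eq]; ring
  simp_rw [h]
  rw [integral_const_mul, integral_cexp_mul_complexHermite hσ]
  have hσ' : (σ : ℂ) ≠ 0 := by exact_mod_cast hσ.ne'
  have h1 : √(σ / Real.pi) * √(Real.pi / σ) = 1 := by
    rw [← Real.sqrt_mul (by positivity)]
    rw [show σ / Real.pi * (Real.pi / σ) = 1 by field_simp, Real.sqrt_one]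
  -- The linear exponent is `c = 2σtz`, so the factor `exp (c² / (4σ))` produced by the Gaussian
  -- integral cancels the prefactor of the kernel.
  have h2 : Complex.exp (-(σ * (t * z) ^ 2)) * Complex.exp ((2 * σ * (t * z)) ^ 2 / (4 * σ)) = 1 := by
    rw [← Complex.exp_add, ← Complex.exp_zero]
    congr 1
    field_simp
    ring
  -- The choice of `t` makes `(2σt)² = σν`; the powers of `σ` then cancel against the Hermite
  -- normalization.
  have h3 : k * (2 * σ * t) ^ n = √(ν ^ n / (2 ^ n * n.factorial)) := by
    have : (2 * σ * t) ^ n = √((σ * ν) ^ n) := by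
      rw [← Real.sqrt_sq (by positivity : 0 ≤ (2 * σ * t) ^ n)]
      congr 1
      rw [← pow_mul, mul_comm n 2, pow_mul, mul_pow, Real.sq_sqrt (by positivity)]
      congr 1
      field_simp
      ring
    rw [this, hk, ← Real.sqrt_mul (by positivity), mul_pow]
    congr 1
    field_simp
  calc _ = ((√(σ / Real.pi) * √(Real.pi / σ) : ℝ) : ℂ) *
        (Complex.exp (-(σ * (t * z) ^ 2)) * Complex.exp ((2 * σ * (t * z)) ^ 2 / (4 * σ))) *
        ((k * (2 * σ * t) ^ n : ℝ) : ℂ) * z ^ n := by push_cast; ring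
    _ = _ := by rw [h1, h2, h3, monomialC]; simp

/-- Parseval's identity for `φ` and the conjugate kernel at `z`, where the Hermite coefficients of
the kernel are the monomials. It holds at every `z`, not merely almost everywhere. -/
theorem hasSum_segalBargmannC {σ ν : ℝ} (hσ : 0 < σ) (hν : 0 < ν) {φ : ℝ → ℂ}
    (hφ : MemLp φ 2 (lineGauss σ)) (z : ℂ) :
    HasSum (fun n => inner ℂ (hermiteLp hσ n) (hφ.toLp φ) * monomialC ν n z)
      (segalBargmannC σ ν φ z) := by
  have hK : MemLp (fun x => starRingEnd ℂ (expKernel σ ν z x)) 2 (lineGauss σ) :=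
    (memLp_expKernel hσ ν z).star
  have hinner {ψ : ℝ → ℂ} (hψ : MemLp ψ 2 (lineGauss σ)) :
      inner ℂ (hK.toLp _) (hψ.toLp ψ) = segalBargmannC σ ν ψ z := by
    rw [inner_toLp_toLp, segalBargmannC_eq hσ]
    simp only [Complex.conj_conj, mul_comm]
  have h := (hermiteBasis hσ).hasSum_inner_mul_inner (hK.toLp _) (hφ.toLp φ)
  rw [hinner hφ] at h
  refine h.congr_fun fun n => ?_
  rw [coe_hermiteBasis, mul_comm, hermiteLp, hinner, segalBargmannC_hermiteC hσ hν]

/-! ### Monomials in the Gaussian space of the plane, and power series. -/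

theorem measurable_planeWeight (ν : ℝ) : Measurable (planeWeight ν) :=
  (continuous_planeWeight ν).measurable

theorem integrable_exp_neg_mul_sq_norm {b : ℝ} (hb : 0 < b) :
    Integrable (fun z : ℂ => Real.exp (-b * ‖z‖ ^ 2)) := by
  have h := (GaussianFourier.integrable_cexp_neg_mul_sq_norm_add (b := b) (V := ℂ)
    (by simpa using hb) 0 0).norm
  refine h.congr (ae_of_all _ fun z => ?_)
  simp [Complex.norm_exp, ← Complex.ofReal_pow]

theorem memLp_monomialC {ν : ℝ} (hν : 0 < ν) (n : ℕ) :
    MemLp (monomialC ν n) 2 (planeGauss ν) := by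
  have hpi := Real.pi_pos
  refine MemLp.const_mul ?_ _
  rw [memLp_two_weightedMeasure_iff (measurable_planeWeight ν) (planeWeight_pos hν)
    (by fun_prop)]
  -- Half of the decay `ν / 2` absorbs `‖z‖ ^ (2n)`; the other half stays integrable.
  refine ((integrable_exp_neg_mul_sq_norm (b := ν / 4) (by positivity)).const_mul
    (ν / (2 * Real.pi) * (n.factorial * (4 / ν) ^ n))).mono' ?_ (ae_of_all _ fun z => ?_)
  · have := continuous_planeWeight ν
    fun_prop
  · have h1 := Real.pow_div_factorial_le_exp (ν / 4 * ‖z‖ ^ 2) (by positivity) n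
    rw [div_le_iff₀ (by positivity), mul_pow] at h1
    have h2 : ‖z ^ n‖ ^ 2 ≤ n.factorial * (4 / ν) ^ n * Real.exp (ν / 4 * ‖z‖ ^ 2) := by
      calc ‖z ^ n‖ ^ 2 = (4 / ν) ^ n * ((ν / 4) ^ n * (‖z‖ ^ 2) ^ n) := by
            rw [← mul_assoc, ← mul_pow, norm_pow]
            rw [show 4 / ν * (ν / 4) = 1 by field_simp]
            ring
        _ ≤ (4 / ν) ^ n * (Real.exp (ν / 4 * ‖z‖ ^ 2) * n.factorial) := by gcongr
        _ = _ := by ring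
    have h3 : Real.exp (-(ν / 2) * ‖z‖ ^ 2) * Real.exp (ν / 4 * ‖z‖ ^ 2) =
        Real.exp (-(ν / 4) * ‖z‖ ^ 2) := by
      rw [← Real.exp_add]; ring_nf
    have hpos := planeWeight_pos hν z
    rw [Real.norm_of_nonneg (by positivity)]
    refine (mul_le_mul_of_nonneg_left h2 hpos.le).trans (le_of_eq ?_)
    rw [planeWeight, ← h3]
    ring

theorem integral_mul_conj_monomialC {ν : ℝ} (hν : 0 < ν) {f : ℂ → ℂ} (hf : Differentiable ℂ f)
    (hf2 : MemLp f 2 (planeGauss ν)) (n : ℕ) :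
    ∫ z, f z * starRingEnd ℂ (monomialC ν n z) ∂(planeGauss ν) =
      (√(ν ^ n / (2 ^ n * n.factorial)) : ℝ) * ((2 / ν) ^ n * iteratedDeriv n f 0) := by
  have hk : (√(ν ^ n / (2 ^ n * n.factorial)) : ℝ) ≠ 0 :=
    (Real.sqrt_pos.mpr (by positivity)).ne'
  have hm := measurable_planeWeight ν
  have hp := planeWeight_pos hν
  have hi := (integrable_weightedMeasure_iff hm hp).mp
    (hf2.integrable_mul (memLp_monomialC hν n).star)
  have heq (z : ℂ) : planeWeight ν z • (f z * starRingEnd ℂ (monomialC ν n z)) =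
      (√(ν ^ n / (2 ^ n * n.factorial)) : ℝ) *
        (planeWeight ν z • (f z * starRingEnd ℂ z ^ n)) := by
    rw [monomialC, map_mul, Complex.conj_ofReal, map_pow, Complex.real_smul, Complex.real_smul]
    ring
  rw [integral_weightedMeasure hm hp]
  simp_rw [heq]
  rw [integral_const_mul, integral_conj_pow_mul_planeWeight hν hf]
  refine (hi.const_mul ((√(ν ^ n / (2 ^ n * n.factorial)) : ℝ) : ℂ)⁻¹).congr
    (ae_of_all _ fun z => ?_)
  have h := heq z
  change _ * (planeWeight ν z • (f z * starRingEnd ℂ (monomialC ν n z))) = _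
  rw [h, inv_mul_cancel_left₀ (by exact_mod_cast hk)]

theorem differentiable_monomialC (ν : ℝ) (n : ℕ) : Differentiable ℂ (monomialC ν n) := by
  unfold monomialC; fun_prop

theorem integral_monomialC_mul {ν : ℝ} (hν : 0 < ν) (m n : ℕ) :
    ∫ z, monomialC ν m z * starRingEnd ℂ (monomialC ν n z) ∂(planeGauss ν) =
      if m = n then 1 else 0 := by
  rw [integral_mul_conj_monomialC hν (differentiable_monomialC ν m) (memLp_monomialC hν m)]
  have h : iteratedDeriv n (monomialC ν m) 0 = (√(ν ^ m / (2 ^ m * m.factorial)) : ℝ) *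
      ((if n = m then m.factorial else 0 : ℕ) : ℂ) := by
    unfold monomialC
    rw [iteratedDeriv_const_mul_field, iteratedDeriv_fun_pow_zero]
  rw [h]
  by_cases hmn : m = n
  · subst hmn
    have h1 : √(ν ^ m / (2 ^ m * m.factorial)) * √(ν ^ m / (2 ^ m * m.factorial)) *
        ((2 / ν) ^ m * m.factorial) = 1 := by
      rw [Real.mul_self_sqrt (by positivity), div_pow]
      field_simp
    simp only [if_true]
    rw [← Complex.ofReal_one, ← h1]
    push_cast
    ring
  · simp [hmn, Ne.symm hmn]

/-- The normalized monomials as elements of `L²`. -/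
def monomialLp {ν : ℝ} (hν : 0 < ν) (n : ℕ) : Lp ℂ 2 (planeGauss ν) :=
  (memLp_monomialC hν n).toLp (monomialC ν n)

theorem orthonormal_monomialLp {ν : ℝ} (hν : 0 < ν) : Orthonormal ℂ (monomialLp hν) := by
  classical
  rw [orthonormal_iff_ite]
  intro m n
  rw [monomialLp, monomialLp, inner_toLp_toLp, integral_monomialC_mul hν]
  simp [eq_comm]

/-- Convergence at the real point `‖z‖ + 1` is already absolute and provides the bounds for the
Weierstrass test on a ball containing `z`. -/
theorem differentiable_of_hasSum_pow {c : ℕ → ℂ} {f : ℂ → ℂ}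
    (h : ∀ z, HasSum (fun n => c n * z ^ n) (f z)) : Differentiable ℂ f := by
  intro z
  have hs : Summable fun n => ‖c n‖ * (‖z‖ + 1) ^ n := by
    refine (h ((‖z‖ + 1 : ℝ) : ℂ)).summable.norm.congr fun n => ?_
    rw [norm_mul, norm_pow, Complex.norm_real, Real.norm_of_nonneg (by positivity)]
  have hd := Complex.differentiableOn_tsum_of_summable_norm (U := Metric.ball 0 (‖z‖ + 1))
    (F := fun n w => c n * w ^ n) hs (fun n => by fun_prop) Metric.isOpen_ball
    fun n w hw => by
      rw [norm_mul, norm_pow]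
      have : ‖w‖ ≤ ‖z‖ + 1 := (mem_ball_zero_iff.mp hw).le
      gcongr
  have hfe : (fun w => ∑' n, c n * w ^ n) = f := funext fun w => (h w).tsum_eq
  rw [hfe] at hd
  exact hd.differentiableAt (Metric.isOpen_ball.mem_nhds (by simp))

theorem differentiable_segalBargmannC {σ ν : ℝ} (hσ : 0 < σ) (hν : 0 < ν) {φ : ℝ → ℂ}
    (hφ : MemLp φ 2 (lineGauss σ)) : Differentiable ℂ (segalBargmannC σ ν φ) :=
  differentiable_of_hasSum_pow
    (c := fun n => inner ℂ (hermiteLp hσ n) (hφ.toLp φ) * (√(ν ^ n / (2 ^ n * n.factorial)) : ℝ))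
    fun z => (hasSum_segalBargmannC hσ hν hφ z).congr_fun fun n => by
      rw [monomialC, mul_assoc]

/-! ### Unitarity and surjectivity in one variable. -/

/-- The isometry of `L²` spaces that maps the Hermite functions to the normalized monomials. -/
def hermiteToMonomial {σ ν : ℝ} (hσ : 0 < σ) (hν : 0 < ν) :
    Lp ℂ 2 (lineGauss σ) →ₗᵢ[ℂ] Lp ℂ 2 (planeGauss ν) :=
  (orthonormal_monomialLp hν).orthogonalFamily.linearIsometry.comp
    (hermiteBasis hσ).repr.toLinearIsometry

theorem hasSum_hermiteToMonomial {σ ν : ℝ} (hσ : 0 < σ) (hν : 0 < ν)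
    (φ : Lp ℂ 2 (lineGauss σ)) :
    HasSum (fun n => inner ℂ (hermiteLp hσ n) φ • monomialLp hν n)
      (hermiteToMonomial hσ hν φ) := by
  have h := (orthonormal_monomialLp hν).orthogonalFamily.hasSum_linearIsometry
    ((hermiteBasis hσ).repr φ)
  refine h.congr_fun fun n => ?_
  rw [HilbertBasis.repr_apply_apply, coe_hermiteBasis]
  rfl

/-- The same partial sums converge in `L²` to the left side and at every point to the right side. An
almost everywhere convergent subsequence forces the limits to agree. -/
theorem hermiteToMonomial_ae_eq {σ ν : ℝ} (hσ : 0 < σ) (hν : 0 < ν) {φ : ℝ → ℂ}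
    (hφ : MemLp φ 2 (lineGauss σ)) :
    hermiteToMonomial hσ hν (hφ.toLp φ) =ᵐ[planeGauss ν] segalBargmannC σ ν φ := by
  have hL := (hasSum_hermiteToMonomial hσ hν (hφ.toLp φ)).tendsto_sum_nat
  obtain ⟨ns, hns, hae⟩ := (tendstoInMeasure_of_tendsto_Lp hL).exists_seq_tendsto_ae
  have hpart : ∀ᵐ z ∂(planeGauss ν), ∀ N : ℕ,
      (∑ n ∈ Finset.range N, inner ℂ (hermiteLp hσ n) (hφ.toLp φ) • monomialLp hν n :
        Lp ℂ 2 (planeGauss ν)) z =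
      ∑ n ∈ Finset.range N, inner ℂ (hermiteLp hσ n) (hφ.toLp φ) * monomialC ν n z := by
    have hterm : ∀ᵐ z ∂(planeGauss ν), ∀ n : ℕ,
        (inner ℂ (hermiteLp hσ n) (hφ.toLp φ) • monomialLp hν n : Lp ℂ 2 (planeGauss ν)) z =
        inner ℂ (hermiteLp hσ n) (hφ.toLp φ) * monomialC ν n z := by
      rw [ae_all_iff]
      intro n
      filter_upwards [Lp.coeFn_smul (inner ℂ (hermiteLp hσ n) (hφ.toLp φ)) (monomialLp hν n),
        (memLp_monomialC hν n).coeFn_toLp] with z h1 h2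
      rw [h1, Pi.smul_apply, monomialLp, h2, smul_eq_mul]
    rw [ae_all_iff]
    intro N
    filter_upwards [hterm, Lp.coeFn_finsetSum (Finset.range N) fun n =>
      (inner ℂ (hermiteLp hσ n) (hφ.toLp φ) • monomialLp hν n)] with z h1 h2
    rw [h2, Finset.sum_apply]
    exact Finset.sum_congr rfl fun n _ => h1 n
  filter_upwards [hae, hpart] with z h1 h2
  simp only [h2] at h1
  exact tendsto_nhds_unique h1
    ((hasSum_segalBargmannC hσ hν hφ z).tendsto_sum_nat.comp hns.tendsto_atTop)

theorem memLp_segalBargmannC {σ ν : ℝ} (hσ : 0 < σ) (hν : 0 < ν) {φ : ℝ → ℂ}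
    (hφ : MemLp φ 2 (lineGauss σ)) : MemLp (segalBargmannC σ ν φ) 2 (planeGauss ν) :=
  (memLp_congr_ae (hermiteToMonomial_ae_eq hσ hν hφ)).mp (Lp.memLp _)

theorem integral_segalBargmannC_mul_conj {σ ν : ℝ} (hσ : 0 < σ) (hν : 0 < ν) {φ ψ : ℝ → ℂ}
    (hφ : MemLp φ 2 (lineGauss σ)) (hψ : MemLp ψ 2 (lineGauss σ)) :
    ∫ z, segalBargmannC σ ν φ z * starRingEnd ℂ (segalBargmannC σ ν ψ z) ∂(planeGauss ν) =
      ∫ x, φ x * starRingEnd ℂ (ψ x) ∂(lineGauss σ) := by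
  rw [← inner_toLp_toLp hψ hφ, ← (hermiteToMonomial hσ hν).inner_map_map, L2.inner_def]
  refine integral_congr_ae ?_
  filter_upwards [hermiteToMonomial_ae_eq hσ hν hφ, hermiteToMonomial_ae_eq hσ hν hψ] with z h1 h2
  rw [h1, h2, RCLike.inner_apply]

theorem ae_eq_zero_of_segalBargmannC_eq_zero {σ ν : ℝ} (hσ : 0 < σ) (hν : 0 < ν) {φ : ℝ → ℂ}
    (hφ : MemLp φ 2 (lineGauss σ)) (h : segalBargmannC σ ν φ = 0) :
    φ =ᵐ[(volume : Measure ℝ)] 0 := by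
  have h1 : hermiteToMonomial hσ hν (hφ.toLp φ) = 0 := by
    rw [Lp.eq_zero_iff_ae_eq_zero]
    filter_upwards [hermiteToMonomial_ae_eq hσ hν hφ] with z hz
    rw [hz, h]
  rw [map_eq_zero_iff _ (hermiteToMonomial hσ hν).injective] at h1
  have h2 := hφ.coeFn_toLp
  rw [h1] at h2
  rw [EventuallyEq, ← ae_weightedMeasure (measurable_lineWeight σ) (lineWeight_pos hσ)]
  exact h2.symm.trans (Lp.coeFn_zero _ _ _)

theorem exists_segalBargmannC_eq {σ ν : ℝ} (hσ : 0 < σ) (hν : 0 < ν) {f : ℂ → ℂ}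
    (hf : Differentiable ℂ f) (hf2 : MemLp f 2 (planeGauss ν)) :
    ∃ φ : ℝ → ℂ, MemLp φ 2 (lineGauss σ) ∧ segalBargmannC σ ν φ = f := by
  have hsum := (orthonormal_monomialLp hν).inner_products_summable (hf2.toLp f)
  -- Bessel's inequality suffices here: completeness of the monomials is not presupposed.
  let a : lp (fun _ : ℕ => ℂ) 2 := ⟨fun n => inner ℂ (monomialLp hν n) (hf2.toLp f), by
    refine (memℓp_gen_iff (by norm_num)).mpr ?_
    simpa using hsum⟩
  set Φ := (hermiteBasis hσ).repr.symm a with hΦ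
  refine ⟨Φ, Lp.memLp Φ, funext fun z => ?_⟩
  have h1 := hasSum_segalBargmannC hσ hν (Lp.memLp Φ) z
  have h2 := Complex.hasSum_taylorSeries_of_entire hf 0 z
  refine h1.unique (h2.congr_fun fun n => ?_)
  have h3 : inner ℂ (hermiteLp hσ n) ((Lp.memLp Φ).toLp Φ) =
      inner ℂ (monomialLp hν n) (hf2.toLp f) := by
    rw [Lp.toLp_coeFn, ← coe_hermiteBasis hσ, ← HilbertBasis.repr_apply_apply, hΦ,
      LinearIsometryEquiv.apply_symm_apply]
  -- The monomial normalization enters twice, from the coefficient and from the monomial itself;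
  -- with the factor `(2 / ν) ^ n` it becomes the Taylor factor `1 / n!`.
  have h4 : √(ν ^ n / (2 ^ n * n.factorial)) * √(ν ^ n / (2 ^ n * n.factorial)) * (2 / ν) ^ n =
      (n.factorial : ℝ)⁻¹ := by
    rw [Real.mul_self_sqrt (by positivity), div_pow]
    field_simp
  rw [h3, monomialLp, inner_toLp_toLp, integral_mul_conj_monomialC hν hf hf2, monomialC]
  calc _ = ((√(ν ^ n / (2 ^ n * n.factorial)) * √(ν ^ n / (2 ^ n * n.factorial)) *
        (2 / ν) ^ n : ℝ) : ℂ) * (z ^ n * iteratedDeriv n f 0) := by push_cast; ring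
    _ = _ := by rw [h4]; simp

/-! ### Idempotent components. -/

/-- `Z ↦ α` as a homomorphism of algebras. -/
def plusHom : Bicomplex →ₐ[ℂ] ℂ where
  toFun := plusPart
  map_one' := by simp [plusPart, QuadraticAlgebra.re_one, QuadraticAlgebra.im_one]
  map_mul' Z W := by
    simp only [plusPart, QuadraticAlgebra.re_mul, QuadraticAlgebra.im_mul]
    linear_combination (-(Z.im * W.im)) * Complex.I_mul_I
  map_zero' := by simp [plusPart]
  map_add' Z W := by simp [plusPart]; ring
  commutes' c := by simp [plusPart]

/-- `Z ↦ β` as a homomorphism of algebras. -/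
def minusHom : Bicomplex →ₐ[ℂ] ℂ where
  toFun := minusPart
  map_one' := by simp [minusPart, QuadraticAlgebra.re_one, QuadraticAlgebra.im_one]
  map_mul' Z W := by
    simp only [minusPart, QuadraticAlgebra.re_mul, QuadraticAlgebra.im_mul]
    linear_combination (-(Z.im * W.im)) * Complex.I_mul_I
  map_zero' := by simp [minusPart]
  map_add' Z W := by simp [minusPart]; ring
  commutes' c := by simp [minusPart]

theorem plusHom_apply (Z : Bicomplex) : plusHom Z = plusPart Z := rfl

theorem minusHom_apply (Z : Bicomplex) : minusHom Z = minusPart Z := rfl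

theorem plusPart_mul (Z W : Bicomplex) : plusPart (Z * W) = plusPart Z * plusPart W :=
  map_mul plusHom Z W

theorem minusPart_mul (Z W : Bicomplex) : minusPart (Z * W) = minusPart Z * minusPart W :=
  map_mul minusHom Z W

/-- The bicomplex number with given idempotent components. -/
def ofParts (a b : ℂ) : Bicomplex := a • ePlus + b • eMinus

@[simp]
theorem plusPart_ofParts (a b : ℂ) : plusPart (ofParts a b) = a := by
  simp [plusPart, ofParts, ePlus, eMinus, j, QuadraticAlgebra.re_one, QuadraticAlgebra.im_one]
  ring_nf
  simp
  ring

@[simp]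
theorem minusPart_ofParts (a b : ℂ) : minusPart (ofParts a b) = b := by
  simp [minusPart, ofParts, ePlus, eMinus, j, QuadraticAlgebra.re_one, QuadraticAlgebra.im_one]
  ring_nf
  simp
  ring

theorem ofParts_parts (Z : Bicomplex) : ofParts (plusPart Z) (minusPart Z) = Z :=
  (eq_idempotent Z).symm

theorem ext_parts {Z W : Bicomplex} (h : plusPart Z = plusPart W)
    (h' : minusPart Z = minusPart W) : Z = W := by
  rw [← ofParts_parts Z, ← ofParts_parts W, h, h']

theorem plusPart_conjStar (Z : Bicomplex) :
    plusPart (conjStar Z) = starRingEnd ℂ (plusPart Z) := by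
  simp [plusPart, conjStar]

theorem minusPart_conjStar (Z : Bicomplex) :
    minusPart (conjStar Z) = starRingEnd ℂ (minusPart Z) := by
  simp [minusPart, conjStar]

/-- The parallelogram law for `z₁` and `i z₂`. The factor 1/2 is why the Gaussian in each component
has exponent `ν / 2`. -/
theorem sq_norm_eq_parts (Z : Bicomplex) :
    ‖Z‖ ^ 2 = (‖plusPart Z‖ ^ 2 + ‖minusPart Z‖ ^ 2) / 2 := by
  have h := parallelogram_law_with_norm ℂ Z.re (Complex.I * Z.im)
  rw [norm_mul, Complex.norm_I, one_mul] at h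
  rw [norm_sq_eq, plusPart, minusPart]
  linarith

theorem plusPart_exp (Z : Bicomplex) : plusPart (exp Z) = Complex.exp (plusPart Z) :=
  plusPart_ofParts _ _

theorem minusPart_exp (Z : Bicomplex) : minusPart (exp Z) = Complex.exp (minusPart Z) :=
  minusPart_ofParts _ _

theorem continuous_plusPart : Continuous plusPart := by
  have := continuous_re
  have := continuous_im
  unfold plusPart; fun_prop

theorem continuous_minusPart : Continuous minusPart := by
  have := continuous_re
  have := continuous_im
  unfold minusPart; fun_prop

/-- `Z ↦ α` as a continuous linear map. -/
def plusCLM : Bicomplex →L[ℂ] ℂ := ⟨plusHom.toLinearMap, continuous_plusPart⟩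

/-- `Z ↦ β` as a continuous linear map. -/
def minusCLM : Bicomplex →L[ℂ] ℂ := ⟨minusHom.toLinearMap, continuous_minusPart⟩

theorem plusPart_segalBargmannKernel (σ ν x : ℝ) (Z : Bicomplex) :
    plusPart (segalBargmannKernel σ ν x Z) = kernelC σ ν x (plusPart Z) := by
  rw [segalBargmannKernel, ← plusHom_apply, map_smul, plusHom_apply, plusPart_exp,
    ← plusHom_apply, map_neg, map_smul, map_pow, map_sub, map_smul, AlgHom.commutes]
  rfl

theorem minusPart_segalBargmannKernel (σ ν x : ℝ) (Z : Bicomplex) :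
    minusPart (segalBargmannKernel σ ν x Z) = kernelC σ ν x (minusPart Z) := by
  rw [segalBargmannKernel, ← minusHom_apply, map_smul, minusHom_apply, minusPart_exp,
    ← minusHom_apply, map_neg, map_smul, map_pow, map_sub, map_smul, AlgHom.commutes]
  rfl

section parts

variable {X : Type*} [MeasurableSpace X] {μ : Measure X}

theorem memLp_iff_parts {F : X → Bicomplex} {p : ENNReal} :
    MemLp F p μ ↔
      MemLp (fun x => plusPart (F x)) p μ ∧ MemLp (fun x => minusPart (F x)) p μ := by
  refine ⟨fun h => ⟨plusCLM.comp_memLp' h, minusCLM.comp_memLp' h⟩, fun ⟨h1, h2⟩ => ?_⟩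
  refine (((ContinuousLinearMap.toSpanSingleton ℂ ePlus).comp_memLp' h1).add
    ((ContinuousLinearMap.toSpanSingleton ℂ eMinus).comp_memLp' h2)).ae_eq
      (ae_of_all _ fun x => ?_)
  exact ofParts_parts (F x)

theorem integrable_iff_parts {F : X → Bicomplex} :
    Integrable F μ ↔
      Integrable (fun x => plusPart (F x)) μ ∧ Integrable (fun x => minusPart (F x)) μ := by
  simp only [← memLp_one_iff_integrable]
  exact memLp_iff_parts

theorem plusPart_integral {F : X → Bicomplex} (hF : Integrable F μ) :
    plusPart (∫ x, F x ∂μ) = ∫ x, plusPart (F x) ∂μ :=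
  (plusCLM.integral_comp_comm hF).symm

theorem minusPart_integral {F : X → Bicomplex} (hF : Integrable F μ) :
    minusPart (∫ x, F x ∂μ) = ∫ x, minusPart (F x) ∂μ :=
  (minusCLM.integral_comp_comm hF).symm

theorem integrable_mul_conjStar {f g : X → Bicomplex} (hf : MemLp f 2 μ) (hg : MemLp g 2 μ) :
    Integrable (fun x => f x * conjStar (g x)) μ := by
  rw [memLp_iff_parts] at hf hg
  rw [integrable_iff_parts]
  constructor
  · refine (hf.1.integrable_mul hg.1.star).congr (ae_of_all _ fun x => ?_)
    simp only [plusPart_mul, plusPart_conjStar]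
    rfl
  · refine (hf.2.integrable_mul hg.2.star).congr (ae_of_all _ fun x => ?_)
    simp only [minusPart_mul, minusPart_conjStar]
    rfl

theorem plusPart_integral_mul_conjStar {f g : X → Bicomplex} (hf : MemLp f 2 μ)
    (hg : MemLp g 2 μ) :
    plusPart (∫ x, f x * conjStar (g x) ∂μ) =
      ∫ x, plusPart (f x) * starRingEnd ℂ (plusPart (g x)) ∂μ := by
  rw [plusPart_integral (integrable_mul_conjStar hf hg)]
  simp only [plusPart_mul, plusPart_conjStar]

theorem minusPart_integral_mul_conjStar {f g : X → Bicomplex} (hf : MemLp f 2 μ)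
    (hg : MemLp g 2 μ) :
    minusPart (∫ x, f x * conjStar (g x) ∂μ) =
      ∫ x, minusPart (f x) * starRingEnd ℂ (minusPart (g x)) ∂μ := by
  rw [minusPart_integral (integrable_mul_conjStar hf hg)]
  simp only [minusPart_mul, minusPart_conjStar]

end parts

/-! ### The bicomplex Gaussian measure as a product. -/

/-- The Gaussian weight `(ν/π)² exp(-ν |Z|²)`. -/
def bicomplexWeight (ν : ℝ) (Z : Bicomplex) : ℝ := (ν / Real.pi) ^ 2 * Real.exp (-ν * ‖Z‖ ^ 2)

/-- The Gaussian measure on the bicomplex numbers with density `bicomplexWeight ν`. -/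
abbrev bicomplexGauss (ν : ℝ) : Measure Bicomplex := weightedMeasure (bicomplexWeight ν)

theorem measurable_bicomplexWeight (ν : ℝ) : Measurable (bicomplexWeight ν) := by
  unfold bicomplexWeight; fun_prop

theorem bicomplexWeight_pos {ν : ℝ} (hν : 0 < ν) (Z : Bicomplex) : 0 < bicomplexWeight ν Z := by
  have := Real.pi_pos
  unfold bicomplexWeight; positivity

/-- The factor 4 comes from `(ν/π)² = 4 (ν/(2π))²` and is cancelled by the Jacobian factor 1/4 of
the change to idempotent coordinates. -/
theorem bicomplexWeight_eq (ν : ℝ) (Z : Bicomplex) :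
    bicomplexWeight ν Z = 4 * (planeWeight ν (plusPart Z) * planeWeight ν (minusPart Z)) := by
  have hpi := Real.pi_pos
  have h : Real.exp (-ν * ‖Z‖ ^ 2) = Real.exp (-(ν / 2) * ‖plusPart Z‖ ^ 2) *
      Real.exp (-(ν / 2) * ‖minusPart Z‖ ^ 2) := by
    rw [← Real.exp_add, sq_norm_eq_parts]; ring_nf
  rw [bicomplexWeight, planeWeight, planeWeight, h]
  field_simp
  ring

theorem bargmannInner_eq {ν : ℝ} (hν : 0 < ν) (f g : Bicomplex → Bicomplex) :
    bargmannInner ν f g = ∫ Z, f Z * conjStar (g Z) ∂(bicomplexGauss ν) := by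
  rw [integral_weightedMeasure (measurable_bicomplexWeight ν) (bicomplexWeight_pos hν),
    bargmannInner, ← integral_smul]
  congr 1
  ext1 Z
  rw [bicomplexWeight, Complex.coe_smul, Complex.coe_smul, smul_smul]

theorem lineInner_eq {σ : ℝ} (hσ : 0 < σ) (φ ψ : ℝ → Bicomplex) :
    lineInner σ φ ψ = ∫ x, φ x * conjStar (ψ x) ∂(lineGauss σ) := by
  rw [integral_weightedMeasure (measurable_lineWeight σ) (lineWeight_pos hσ),
    lineInner, ← integral_smul]
  congr 1
  ext1 x
  rw [lineWeight, Complex.coe_smul, Complex.coe_smul, smul_smul]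

/-- `(z₁, z₂) ↦ (z₁ - i z₂, z₁ + i z₂)`. -/
def partsMap : ℂ × ℂ →ₗ[ℂ] ℂ × ℂ where
  toFun p := (p.1 - Complex.I * p.2, p.1 + Complex.I * p.2)
  map_add' p q := by ext <;> simp <;> ring
  map_smul' c p := by ext <;> simp <;> ring

theorem det_partsMap : LinearMap.det partsMap = 2 * Complex.I := by
  rw [← LinearMap.det_toMatrix (Module.Basis.finTwoProd ℂ), Matrix.det_fin_two]
  simp [LinearMap.toMatrix_apply, partsMap]
  ring

theorem map_partsMap_volume :
    Measure.map partsMap (volume : Measure (ℂ × ℂ)) = ENNReal.ofReal (1 / 4) • volume := by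
  -- The real determinant of a complex linear map is the squared modulus of its complex determinant,
  -- here `|2i|²`.
  have hdet : LinearMap.det (partsMap.restrictScalars ℝ) = 4 := by
    rw [LinearMap.det_restrictScalars, det_partsMap, Algebra.norm_complex_apply]
    simp [Complex.normSq_apply]; norm_num
  have h := Measure.map_linearMap_addHaar_eq_smul_addHaar ((volume : Measure ℂ).prod volume)
    (f := partsMap.restrictScalars ℝ) (by rw [hdet]; norm_num)
  rw [hdet, show |(4 : ℝ)⁻¹| = 1 / 4 by norm_num] at h
  exact h

theorem lintegral_comp_parts {g : ℂ × ℂ → ENNReal} (hg : Measurable g) :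
    ∫⁻ Z : Bicomplex, g (plusPart Z, minusPart Z) = ENNReal.ofReal (1 / 4) * ∫⁻ p, g p := by
  have hE : Measurable fun Z : Bicomplex => (plusPart Z, minusPart Z) :=
    (continuous_plusPart.prodMk continuous_minusPart).measurable
  have hP : Measurable partsMap := partsMap.continuous_of_finiteDimensional.measurable
  calc _ = ∫⁻ p : ℂ × ℂ, g (partsMap p) :=
        lintegral_map (f := fun Z => g (plusPart Z, minusPart Z)) (hg.comp hE)
          isHomeomorph_mk.continuous.measurable
    _ = ∫⁻ p, g p ∂(Measure.map partsMap volume) := (lintegral_map hg hP).symm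
    _ = _ := by rw [map_partsMap_volume, lintegral_smul_measure, smul_eq_mul]

/-- The monomial of degree zero is the constant 1 and has norm one. Total mass one ensures that each
marginal of the product is `planeGauss ν` itself. -/
theorem isProbabilityMeasure_planeGauss {ν : ℝ} (hν : 0 < ν) :
    IsProbabilityMeasure (planeGauss ν) := by
  have h := integral_monomialC_mul hν 0 0
  have h1 : monomialC ν 0 = fun _ => 1 := by ext z; simp [monomialC]
  simp only [h1, map_one, mul_one, integral_const, if_true] at h
  have h2 : (planeGauss ν).real Set.univ = 1 := by
    simpa [Complex.real_smul] using h
  refine ⟨?_⟩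
  have h3 := ENNReal.ofReal_toReal (a := planeGauss ν Set.univ) (fun h => by
    simp [Measure.real, h] at h2)
  rw [← h3]
  change ENNReal.ofReal ((planeGauss ν).real Set.univ) = 1
  rw [h2, ENNReal.ofReal_one]

theorem measurePreserving_parts {ν : ℝ} (hν : 0 < ν) :
    MeasurePreserving (fun Z : Bicomplex => (plusPart Z, minusPart Z)) (bicomplexGauss ν)
      ((planeGauss ν).prod (planeGauss ν)) := by
  have hE : Measurable fun Z : Bicomplex => (plusPart Z, minusPart Z) :=
    (continuous_plusPart.prodMk continuous_minusPart).measurable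
  have hw := (measurable_planeWeight ν).ennreal_ofReal
  have hm : Measurable fun p : ℂ × ℂ =>
      ENNReal.ofReal (planeWeight ν p.1) * ENNReal.ofReal (planeWeight ν p.2) :=
    (hw.comp measurable_fst).mul (hw.comp measurable_snd)
  have := isProbabilityMeasure_planeGauss hν
  refine ⟨hE, Measure.ext_of_lintegral _ fun f hf => ?_⟩
  rw [lintegral_map hf hE]
  refine (lintegral_withDensity_eq_lintegral_mul _
    (measurable_bicomplexWeight ν).ennreal_ofReal (hf.comp hE)).trans ?_
  have h1 : (planeGauss ν).prod (planeGauss ν) = (volume : Measure (ℂ × ℂ)).withDensity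
      fun p => ENNReal.ofReal (planeWeight ν p.1) * ENNReal.ofReal (planeWeight ν p.2) :=
    prod_withDensity hw hw
  rw [h1, lintegral_withDensity_eq_lintegral_mul _ hm hf]
  have h2 : (fun Z : Bicomplex => ((fun Z => ENNReal.ofReal (bicomplexWeight ν Z)) *
      fun Z => f (plusPart Z, minusPart Z)) Z) = fun Z : Bicomplex =>
      (fun p : ℂ × ℂ => 4 * ((ENNReal.ofReal (planeWeight ν p.1) *
        ENNReal.ofReal (planeWeight ν p.2)) * f p)) (plusPart Z, minusPart Z) := by
    ext Z
    simp only [Pi.mul_apply, bicomplexWeight_eq]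
    rw [ENNReal.ofReal_mul (by norm_num), ENNReal.ofReal_mul (planeWeight_pos hν _).le,
      ENNReal.ofReal_ofNat, mul_assoc]
  refine ((congrArg (fun F => ∫⁻ Z : Bicomplex, F Z) h2).trans
    (lintegral_comp_parts ((hm.mul hf).const_mul 4))).trans ?_
  rw [lintegral_const_mul _ (hm.mul hf), ← mul_assoc, ← ENNReal.ofReal_ofNat 4, ← ENNReal.ofReal_mul (by norm_num)]
  norm_num

theorem measurePreserving_plusPart {ν : ℝ} (hν : 0 < ν) :
    MeasurePreserving plusPart (bicomplexGauss ν) (planeGauss ν) :=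
  have := isProbabilityMeasure_planeGauss hν
  measurePreserving_fst.comp (measurePreserving_parts hν)

theorem measurePreserving_minusPart {ν : ℝ} (hν : 0 < ν) :
    MeasurePreserving minusPart (bicomplexGauss ν) (planeGauss ν) :=
  have := isProbabilityMeasure_planeGauss hν
  measurePreserving_snd.comp (measurePreserving_parts hν)

/-! ### Bicomplex holomorphy as a pair of entire functions. -/

section separation

variable {F : ℂ → ℂ → ℂ}

/-- A convergent quotient is eventually bounded, so for fixed small `k ≠ 0` the difference `F (a +
t) (b + k) - F a b` is `O(t)`. The limit as `t → 0` is thus the same for all nearby second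
arguments. -/
theorem eventually_tendsto_of_tendsto_quotient {a b L : ℂ}
    (h : Tendsto (fun p : ℂ × ℂ => (F (a + p.1) (b + p.2) - F a b) * p.1⁻¹)
      (𝓝[≠] 0 ×ˢ 𝓝[≠] 0) (𝓝 L)) :
    ∀ᶠ y in 𝓝[≠] b, Tendsto (fun t => F (a + t) y) (𝓝[≠] 0) (𝓝 (F a b)) := by
  have hb := (eventually_swap_iff.mp (h.norm.eventually (gt_mem_nhds (lt_add_one ‖L‖)))).curry
  have hmap : 𝓝[≠] b = map (fun x => b + x) (𝓝[≠] 0) := by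
    rw [map_add_left_nhdsNE, add_zero]
  rw [hmap, eventually_map]
  filter_upwards [hb] with k hk
  have hlim : Tendsto (fun t : ℂ => (‖L‖ + 1) * ‖t‖) (𝓝[≠] 0) (𝓝 0) := by
    have : Tendsto (fun t : ℂ => (‖L‖ + 1) * ‖t‖) (𝓝 0) (𝓝 ((‖L‖ + 1) * ‖(0 : ℂ)‖)) :=
      Continuous.tendsto (by fun_prop) 0
    rw [norm_zero, mul_zero] at this
    exact this.mono_left nhdsWithin_le_nhds
  rw [tendsto_iff_norm_sub_tendsto_zero]
  refine squeeze_zero' (.of_forall fun t => norm_nonneg _) ?_ hlim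
  filter_upwards [hk, self_mem_nhdsWithin] with t ht ht0
  have ht0' : 0 < ‖t‖ := norm_pos_iff.mpr ht0
  simp only [Prod.swap_prod_mk, norm_mul, norm_inv] at ht
  rw [← div_eq_mul_inv, div_lt_iff₀ ht0'] at ht
  exact ht.le

/-- A function of two complex variables that has a derivative in the first variable along all
increments with nonzero components does not depend on the second variable. -/
theorem eq_of_tendsto_quotient
    (h : ∀ a b, ∃ L, Tendsto (fun p : ℂ × ℂ => (F (a + p.1) (b + p.2) - F a b) * p.1⁻¹)
      (𝓝[≠] 0 ×ˢ 𝓝[≠] 0) (𝓝 L)) (a b b' : ℂ) : F a b = F a b' := by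
  have hT (b : ℂ) : ∀ᶠ y in 𝓝[≠] b, Tendsto (fun t => F (a + t) y) (𝓝[≠] 0) (𝓝 (F a b)) :=
    (h a b).elim fun L hL => eventually_tendsto_of_tendsto_quotient hL
  refine IsLocallyConstant.apply_eq_of_preconnectedSpace (f := F a) ?_ b b'
  rw [IsLocallyConstant.iff_eventually_eq]
  intro b
  have h1 : ∀ᶠ y in 𝓝[≠] b, F a y = F a b := by
    -- Applied at `b` and again at a nearby `y`, the previous lemma gives, at a common third point
    -- `x`, the two limits `F a b` and `F a y`. Hence `F a` is locally constant.
    filter_upwards [eventually_eventually_nhdsWithin.mpr (hT b), self_mem_nhdsWithin] with y hy hyb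
    have hy' : ∀ᶠ x in 𝓝[≠] y, Tendsto (fun t => F (a + t) x) (𝓝[≠] 0) (𝓝 (F a b)) := by
      rw [isOpen_compl_singleton.nhdsWithin_eq hyb] at hy
      exact nhdsWithin_le_nhds hy
    obtain ⟨x, hx1, hx2⟩ := (hy'.and (hT y)).exists
    exact tendsto_nhds_unique hx2 hx1
  rw [eventually_nhdsWithin_iff] at h1
  filter_upwards [h1] with y hy
  by_cases hyb : y = b
  · rw [hyb]
  · exact hy hyb

theorem differentiable_of_tendsto_quotient
    (h : ∀ a b, ∃ L, Tendsto (fun p : ℂ × ℂ => (F (a + p.1) (b + p.2) - F a b) * p.1⁻¹)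
      (𝓝[≠] 0 ×ˢ 𝓝[≠] 0) (𝓝 L)) : Differentiable ℂ fun a => F a 0 := by
  intro a
  obtain ⟨L, hL⟩ := h a 0
  have hd : HasDerivAt (fun a => F a 0) L a := by
    rw [hasDerivAt_iff_tendsto_slope_zero]
    -- Along the diagonal increments `(t, t)` the quotient is an ordinary difference quotient, since
    -- the second argument does not matter.
    refine (hL.comp (tendsto_id.prodMk tendsto_id)).congr fun t => ?_
    simp only [Function.comp_apply, id_eq, smul_eq_mul]
    rw [eq_of_tendsto_quotient h (a + t) (0 + t) 0, mul_comm]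
  exact hd.differentiableAt

end separation

/-- The equation of the null cone factors as `z₁² + z₂² = α β`. -/
theorem mem_nullCone_compl_iff {H : Bicomplex} :
    H ∈ nullConeᶜ ↔ plusPart H ≠ 0 ∧ minusPart H ≠ 0 := by
  have h : H.re ^ 2 + H.im ^ 2 = plusPart H * minusPart H := by
    rw [plusPart, minusPart]
    linear_combination (H.im ^ 2) * Complex.I_mul_I
  rw [Set.mem_compl_iff, nullCone, Set.mem_ofPred_eq, h, mul_eq_zero, not_or]

theorem ofParts_mul (a b c d : ℂ) : ofParts a b * ofParts c d = ofParts (a * c) (b * d) :=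
  ext_parts
    (by simp [plusPart_mul])
    (by simp [minusPart_mul])

theorem ofParts_one : ofParts 1 1 = 1 :=
  ext_parts
    (by rw [plusPart_ofParts, ← plusHom_apply, map_one])
    (by rw [minusPart_ofParts, ← minusHom_apply, map_one])

theorem ofParts_add (a b c d : ℂ) : ofParts (a + c) (b + d) = ofParts a b + ofParts c d := by
  simp only [ofParts, add_smul]; abel

theorem inverse_eq_ofParts {H : Bicomplex} (hH : H ∈ nullConeᶜ) :
    Ring.inverse H = ofParts (plusPart H)⁻¹ (minusPart H)⁻¹ := by
  obtain ⟨h1, h2⟩ := mem_nullCone_compl_iff.mp hH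
  have h : H * ofParts (plusPart H)⁻¹ (minusPart H)⁻¹ = 1 := by
    nth_rewrite 1 [← ofParts_parts H]
    rw [ofParts_mul, mul_inv_cancel₀ h1, mul_inv_cancel₀ h2, ofParts_one]
  have hu : IsUnit H := IsUnit.of_mul_eq_one _ h
  calc _ = Ring.inverse H * (H * ofParts (plusPart H)⁻¹ (minusPart H)⁻¹) := by rw [h, mul_one]
    _ = _ := by rw [← mul_assoc, Ring.inverse_mul_cancel _ hu, one_mul]

theorem continuous_ofParts : Continuous fun p : ℂ × ℂ => ofParts p.1 p.2 := by
  unfold ofParts; fun_prop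

theorem tendsto_ofParts :
    Tendsto (fun p : ℂ × ℂ => ofParts p.1 p.2) (𝓝[≠] 0 ×ˢ 𝓝[≠] 0) (𝓝[nullConeᶜ] 0) := by
  rw [← nhdsWithin_prod_eq]
  refine tendsto_nhdsWithin_iff.mpr ⟨?_, ?_⟩
  · have h := continuous_ofParts.tendsto (0, 0)
    have h0 : ofParts 0 0 = 0 := by simp [ofParts]
    simp only [h0] at h
    exact h.mono_left nhdsWithin_le_nhds
  · filter_upwards [self_mem_nhdsWithin] with p hp
    rw [mem_nullCone_compl_iff, plusPart_ofParts, minusPart_ofParts]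
    exact hp

theorem tendsto_plusPart : Tendsto plusPart (𝓝[nullConeᶜ] 0) (𝓝[≠] 0) := by
  refine tendsto_nhdsWithin_iff.mpr ⟨?_, ?_⟩
  · have h := continuous_plusPart.tendsto 0
    rw [← plusHom_apply, map_zero] at h
    exact h.mono_left nhdsWithin_le_nhds
  · filter_upwards [self_mem_nhdsWithin] with H hH
    exact (mem_nullCone_compl_iff.mp hH).1

theorem tendsto_minusPart : Tendsto minusPart (𝓝[nullConeᶜ] 0) (𝓝[≠] 0) := by
  refine tendsto_nhdsWithin_iff.mpr ⟨?_, ?_⟩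
  · have h := continuous_minusPart.tendsto 0
    rw [← minusHom_apply, map_zero] at h
    exact h.mono_left nhdsWithin_le_nhds
  · filter_upwards [self_mem_nhdsWithin] with H hH
    exact (mem_nullCone_compl_iff.mp hH).2

theorem IsHolomorphic.exists_parts {f : Bicomplex → Bicomplex} (hf : IsHolomorphic f) :
    ∃ u v : ℂ → ℂ, Differentiable ℂ u ∧ Differentiable ℂ v ∧
      ∀ Z, f Z = ofParts (u (plusPart Z)) (v (minusPart Z)) := by
  have key (a b : ℂ) : ∃ L : Bicomplex, Tendsto (fun p : ℂ × ℂ =>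
      (f (ofParts (a + p.1) (b + p.2)) - f (ofParts a b)) * ofParts p.1⁻¹ p.2⁻¹)
      (𝓝[≠] 0 ×ˢ 𝓝[≠] 0) (𝓝 L) := by
    obtain ⟨L, hL⟩ := hf (ofParts a b)
    refine ⟨L, (hL.comp tendsto_ofParts).congr' ?_⟩
    filter_upwards [tendsto_ofParts.eventually self_mem_nhdsWithin] with p hp
    rw [Function.comp_apply, inverse_eq_ofParts hp, plusPart_ofParts, minusPart_ofParts,
      ofParts_add]
  have hplus (a b : ℂ) : ∃ L, Tendsto (fun p : ℂ × ℂ =>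
      (plusPart (f (ofParts (a + p.1) (b + p.2))) - plusPart (f (ofParts a b))) * p.1⁻¹)
      (𝓝[≠] 0 ×ˢ 𝓝[≠] 0) (𝓝 L) := by
    obtain ⟨L, hL⟩ := key a b
    refine ⟨plusPart L, ((continuous_plusPart.tendsto L).comp hL).congr fun p => ?_⟩
    simp only [Function.comp_apply, ← plusHom_apply, map_mul, map_sub]
    rw [plusHom_apply (ofParts p.1⁻¹ p.2⁻¹), plusPart_ofParts]
  -- The variables are swapped so that the separation lemmas apply with `β` as first variable.
  have hminus (b a : ℂ) : ∃ L, Tendsto (fun p : ℂ × ℂ =>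
      (minusPart (f (ofParts (a + p.2) (b + p.1))) - minusPart (f (ofParts a b))) * p.1⁻¹)
      (𝓝[≠] 0 ×ˢ 𝓝[≠] 0) (𝓝 L) := by
    obtain ⟨L, hL⟩ := key a b
    refine ⟨minusPart L,
      ((continuous_minusPart.tendsto L).comp (hL.comp tendsto_prod_swap)).congr fun p => ?_⟩
    simp only [Function.comp_apply, ← minusHom_apply, map_mul, map_sub, Prod.fst_swap,
      Prod.snd_swap]
    rw [minusHom_apply (ofParts p.2⁻¹ p.1⁻¹), minusPart_ofParts]
  refine ⟨fun a => plusPart (f (ofParts a 0)), fun b => minusPart (f (ofParts 0 b)),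
    differentiable_of_tendsto_quotient (F := fun a b => plusPart (f (ofParts a b))) hplus,
    differentiable_of_tendsto_quotient (F := fun b a => minusPart (f (ofParts a b))) hminus,
    fun Z => ext_parts ?_ ?_⟩
  · rw [plusPart_ofParts]
    conv_lhs => rw [← ofParts_parts Z]
    exact eq_of_tendsto_quotient (F := fun a b => plusPart (f (ofParts a b))) hplus _ _ _
  · rw [minusPart_ofParts]
    conv_lhs => rw [← ofParts_parts Z]
    exact eq_of_tendsto_quotient (F := fun b a => minusPart (f (ofParts a b))) hminus _ _ _

theorem isHolomorphic_ofParts {u v : ℂ → ℂ} (hu : Differentiable ℂ u) (hv : Differentiable ℂ v) :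
    IsHolomorphic fun Z => ofParts (u (plusPart Z)) (v (minusPart Z)) := by
  intro Z
  have hu' := (hasDerivAt_iff_tendsto_slope_zero.mp (hu (plusPart Z)).hasDerivAt).comp
    tendsto_plusPart
  have hv' := (hasDerivAt_iff_tendsto_slope_zero.mp (hv (minusPart Z)).hasDerivAt).comp
    tendsto_minusPart
  refine ⟨_, ((continuous_ofParts.tendsto _).comp (hu'.prodMk_nhds hv')).congr' ?_⟩
  filter_upwards [self_mem_nhdsWithin] with H hH
  rw [inverse_eq_ofParts hH]
  refine ext_parts ?_ ?_
  · simp only [Function.comp_apply, plusPart_ofParts]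
    simp only [← plusHom_apply, map_mul, map_sub, map_add]
    simp only [plusHom_apply, plusPart_ofParts, smul_eq_mul, mul_comm]
  · simp only [Function.comp_apply, minusPart_ofParts]
    simp only [← minusHom_apply, map_mul, map_sub, map_add]
    simp only [minusHom_apply, minusPart_ofParts, smul_eq_mul, mul_comm]

/-! ### The bicomplex transform assembled from its components. -/

theorem memLp_of_mem_lineL2 {σ : ℝ} (hσ : 0 < σ) (φ : lineL2 σ) :
    MemLp (φ.1 : ℝ → Bicomplex) 2 (lineGauss σ) := by
  rw [memLp_two_weightedMeasure_iff (measurable_lineWeight σ) (lineWeight_pos hσ)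
    φ.1.aestronglyMeasurable]
  have h : Integrable (fun x : ℝ => Real.exp (-σ * x ^ 2) * ‖φ.1 x‖ ^ 2) := φ.2
  refine (h.const_mul √(σ / Real.pi)).congr (ae_of_all _ fun x => ?_)
  simp only [lineWeight, mul_assoc]

theorem exists_lineL2_of_memLp {σ : ℝ} (hσ : 0 < σ) {F : ℝ → Bicomplex}
    (hF : MemLp F 2 (lineGauss σ)) : ∃ φ : lineL2 σ, (φ.1 : ℝ → Bicomplex) =ᵐ[volume] F := by
  have hpi := Real.pi_pos
  have hac : (volume : Measure ℝ) ≪ lineGauss σ := by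
    refine Measure.ae_le_iff_absolutelyContinuous.mp ?_
    rw [ae_weightedMeasure (measurable_lineWeight σ) (lineWeight_pos hσ)]
  have hm : AEStronglyMeasurable F volume := hF.1.mono_ac hac
  have hc : √(σ / Real.pi) ≠ 0 := (Real.sqrt_pos.mpr (by positivity)).ne'
  have h := ((memLp_two_weightedMeasure_iff (measurable_lineWeight σ) (lineWeight_pos hσ)
    hm).mp hF).const_mul (√(σ / Real.pi))⁻¹
  refine ⟨⟨AEEqFun.mk F hm, h.congr ?_⟩, AEEqFun.coeFn_mk F hm⟩
  filter_upwards [AEEqFun.coeFn_mk F hm] with x hx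
  rw [hx, lineWeight, mul_assoc, inv_mul_cancel_left₀ hc]

theorem memLp_bicomplexGauss_iff {ν : ℝ} (hν : 0 < ν) {f : Bicomplex → Bicomplex}
    (hf : Measurable f) : MemLp f 2 (bicomplexGauss ν) ↔
      Integrable (fun Z : Bicomplex => Real.exp (-ν * ‖Z‖ ^ 2) * ‖f Z‖ ^ 2) := by
  have hpi := Real.pi_pos
  have hc : IsUnit ((ν / Real.pi) ^ 2) := isUnit_iff_ne_zero.mpr (by positivity)
  rw [memLp_two_weightedMeasure_iff (measurable_bicomplexWeight ν) (bicomplexWeight_pos hν)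
    hf.aestronglyMeasurable]
  simp only [bicomplexWeight, mul_assoc]
  exact integrable_const_mul_iff hc _

theorem ofParts_mem_bargmannSpace {ν : ℝ} (hν : 0 < ν) {u v : ℂ → ℂ} (hu : Differentiable ℂ u)
    (hv : Differentiable ℂ v) (hu2 : MemLp u 2 (planeGauss ν)) (hv2 : MemLp v 2 (planeGauss ν)) :
    (fun Z => ofParts (u (plusPart Z)) (v (minusPart Z))) ∈ bargmannSpace ν := by
  have hc : Continuous fun Z : Bicomplex => ofParts (u (plusPart Z)) (v (minusPart Z)) :=
    continuous_ofParts.comp ((hu.continuous.comp continuous_plusPart).prodMk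
      (hv.continuous.comp continuous_minusPart))
  refine ⟨⟨hc.measurable, ?_⟩, isHolomorphic_ofParts hu hv⟩
  rw [← memLp_bicomplexGauss_iff hν hc.measurable, memLp_iff_parts]
  simp only [plusPart_ofParts, minusPart_ofParts]
  exact ⟨hu2.comp_measurePreserving (measurePreserving_plusPart hν),
    hv2.comp_measurePreserving (measurePreserving_minusPart hν)⟩

/-- Square integrability descends to `u` and `v` because the Gaussian measure projects onto
`planeGauss ν` along each component. -/
theorem exists_parts_of_mem_bargmannSpace {ν : ℝ} (hν : 0 < ν) {f : Bicomplex → Bicomplex}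
    (hf : f ∈ bargmannSpace ν) :
    ∃ u v : ℂ → ℂ, Differentiable ℂ u ∧ Differentiable ℂ v ∧ MemLp u 2 (planeGauss ν) ∧
      MemLp v 2 (planeGauss ν) ∧ f = fun Z => ofParts (u (plusPart Z)) (v (minusPart Z)) := by
  obtain ⟨⟨hfm, hfi⟩, hfh⟩ := hf
  obtain ⟨u, v, hu, hv, huv⟩ := IsHolomorphic.exists_parts hfh
  have h := (memLp_bicomplexGauss_iff hν hfm).mpr hfi
  rw [memLp_iff_parts] at h
  simp only [huv, plusPart_ofParts, minusPart_ofParts] at h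
  refine ⟨u, v, hu, hv, ?_, ?_, funext huv⟩
  · rw [← (measurePreserving_plusPart hν).map_eq]
    exact (memLp_map_measure_iff hu.continuous.aestronglyMeasurable
      continuous_plusPart.aemeasurable).mpr h.1
  · rw [← (measurePreserving_minusPart hν).map_eq]
    exact (memLp_map_measure_iff hv.continuous.aestronglyMeasurable
      continuous_minusPart.aemeasurable).mpr h.2

theorem bargmannInner_ofParts {ν : ℝ} (hν : 0 < ν) {u v u' v' : ℂ → ℂ}
    (hu : Continuous u) (hv : Continuous v) (hu' : Continuous u') (hv' : Continuous v')
    (hu2 : MemLp u 2 (planeGauss ν)) (hv2 : MemLp v 2 (planeGauss ν))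
    (hu2' : MemLp u' 2 (planeGauss ν)) (hv2' : MemLp v' 2 (planeGauss ν)) :
    bargmannInner ν (fun Z => ofParts (u (plusPart Z)) (v (minusPart Z)))
        (fun Z => ofParts (u' (plusPart Z)) (v' (minusPart Z))) =
      ofParts (∫ z, u z * starRingEnd ℂ (u' z) ∂(planeGauss ν))
        (∫ z, v z * starRingEnd ℂ (v' z) ∂(planeGauss ν)) := by
  have hmem {u v : ℂ → ℂ} (hu2 : MemLp u 2 (planeGauss ν)) (hv2 : MemLp v 2 (planeGauss ν)) :
      MemLp (fun Z => ofParts (u (plusPart Z)) (v (minusPart Z))) 2 (bicomplexGauss ν) := by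
    rw [memLp_iff_parts]
    simp only [plusPart_ofParts, minusPart_ofParts]
    exact ⟨hu2.comp_measurePreserving (measurePreserving_plusPart hν),
      hv2.comp_measurePreserving (measurePreserving_minusPart hν)⟩
  rw [bargmannInner_eq hν]
  refine ext_parts ?_ ?_
  · rw [plusPart_integral_mul_conjStar (hmem hu2 hv2) (hmem hu2' hv2')]
    simp only [plusPart_ofParts]
    rw [← (measurePreserving_plusPart hν).map_eq]
    exact (integral_map continuous_plusPart.aemeasurable (f := fun z => u z * starRingEnd ℂ (u' z))
      (Continuous.aestronglyMeasurable (by fun_prop))).symm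
  · rw [minusPart_integral_mul_conjStar (hmem hu2 hv2) (hmem hu2' hv2')]
    simp only [minusPart_ofParts]
    rw [← (measurePreserving_minusPart hν).map_eq]
    exact (integral_map continuous_minusPart.aemeasurable
      (f := fun z => v z * starRingEnd ℂ (v' z))
      (Continuous.aestronglyMeasurable (by fun_prop))).symm

theorem integrable_segalBargmannKernel_mul {σ : ℝ} (hσ : 0 < σ) (ν : ℝ) {F : ℝ → Bicomplex}
    (hF : MemLp F 2 (lineGauss σ)) (Z : Bicomplex) :
    Integrable (fun x : ℝ => segalBargmannKernel σ ν x Z * F x) := by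
  rw [memLp_iff_parts] at hF
  rw [integrable_iff_parts]
  constructor
  · refine (integrable_kernelC_mul hσ ν hF.1 (plusPart Z)).congr (ae_of_all _ fun x => ?_)
    simp only [plusPart_segalBargmannKernel, plusPart_mul]
  · refine (integrable_kernelC_mul hσ ν hF.2 (minusPart Z)).congr (ae_of_all _ fun x => ?_)
    simp only [minusPart_segalBargmannKernel, minusPart_mul]

theorem segalBargmann_eq {σ : ℝ} (hσ : 0 < σ) (ν : ℝ) {F : ℝ → Bicomplex}
    (hF : MemLp F 2 (lineGauss σ)) :
    segalBargmann σ ν F = fun Z =>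
      ofParts (segalBargmannC σ ν (fun x => plusPart (F x)) (plusPart Z))
        (segalBargmannC σ ν (fun x => minusPart (F x)) (minusPart Z)) := by
  ext1 Z
  have hi := integrable_segalBargmannKernel_mul hσ ν hF Z
  refine ext_parts ?_ ?_
  · rw [segalBargmann, plusPart_integral hi, plusPart_ofParts, segalBargmannC]
    simp only [plusPart_segalBargmannKernel, plusPart_mul]
  · rw [segalBargmann, minusPart_integral hi, minusPart_ofParts, segalBargmannC]
    simp only [minusPart_segalBargmannKernel, minusPart_mul]

theorem segalBargmann_mem {σ ν : ℝ} (hσ : 0 < σ) (hν : 0 < ν) {F : ℝ → Bicomplex}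
    (hF : MemLp F 2 (lineGauss σ)) : segalBargmann σ ν F ∈ bargmannSpace ν := by
  have hF' := memLp_iff_parts.mp hF
  rw [segalBargmann_eq hσ ν hF]
  exact ofParts_mem_bargmannSpace hν (differentiable_segalBargmannC hσ hν hF'.1)
    (differentiable_segalBargmannC hσ hν hF'.2) (memLp_segalBargmannC hσ hν hF'.1)
    (memLp_segalBargmannC hσ hν hF'.2)

theorem segalBargmann_congr_ae (σ ν : ℝ) {F G : ℝ → Bicomplex} (h : F =ᵐ[volume] G) :
    segalBargmann σ ν F = segalBargmann σ ν G := by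
  ext1 Z
  refine integral_congr_ae ?_
  filter_upwards [h] with x hx
  rw [hx]

/-- Multiplication by a bicomplex number as a continuous linear map. -/
def mulCLM (c : Bicomplex) : Bicomplex →L[ℂ] Bicomplex :=
  ⟨LinearMap.mulLeft ℂ c, continuous_const.mul continuous_id⟩

/-- The Segal–Bargmann transform as a linear map. -/
def segalBargmannLinear {σ ν : ℝ} (hσ : 0 < σ) (hν : 0 < ν) :
    lineL2 σ →ₗ[Bicomplex] bargmannSpace ν where
  toFun φ := ⟨segalBargmann σ ν φ.1, segalBargmann_mem hσ hν (memLp_of_mem_lineL2 hσ φ)⟩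
  map_add' φ ψ := by
    refine Subtype.ext (funext fun Z => ?_)
    have h := integral_add
      (integrable_segalBargmannKernel_mul hσ ν (memLp_of_mem_lineL2 hσ φ) Z)
      (integrable_segalBargmannKernel_mul hσ ν (memLp_of_mem_lineL2 hσ ψ) Z)
    refine Eq.trans (integral_congr_ae ?_) h
    filter_upwards [AEEqFun.coeFn_add φ.1 ψ.1] with x hx
    rw [Submodule.coe_add, hx, Pi.add_apply, mul_add]
  map_smul' c φ := by
    refine Subtype.ext (funext fun Z => ?_)
    have h := (mulCLM c).integral_comp_comm
      (integrable_segalBargmannKernel_mul hσ ν (memLp_of_mem_lineL2 hσ φ) Z)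
    refine Eq.trans (integral_congr_ae ?_) h
    filter_upwards [AEEqFun.coeFn_smul c φ.1] with x hx
    rw [Submodule.coe_smul, hx, Pi.smul_apply, smul_eq_mul]
    exact mul_left_comm _ _ _

theorem segalBargmannLinear_injective {σ ν : ℝ} (hσ : 0 < σ) (hν : 0 < ν) :
    Function.Injective (segalBargmannLinear hσ hν) := by
  rw [injective_iff_map_eq_zero]
  intro φ h
  have hφ := memLp_of_mem_lineL2 hσ φ
  have hφ' := memLp_iff_parts.mp hφ
  have h0 : segalBargmann σ ν φ.1 = 0 := congrArg Subtype.val h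
  rw [segalBargmann_eq hσ ν hφ] at h0
  -- The components `a` and `b` vary independently, so both one-variable transforms vanish
  -- identically.
  have hz (a b : ℂ) := congrFun h0 (ofParts a b)
  simp only [plusPart_ofParts, minusPart_ofParts, Pi.zero_apply] at hz
  have h1 := ae_eq_zero_of_segalBargmannC_eq_zero hσ hν hφ'.1 (funext fun a => by
    have := congrArg plusHom (hz a 0)
    rwa [plusHom_apply, plusPart_ofParts, map_zero] at this)
  have h2 := ae_eq_zero_of_segalBargmannC_eq_zero hσ hν hφ'.2 (funext fun b => by
    have := congrArg minusHom (hz 0 b)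
    rwa [minusHom_apply, minusPart_ofParts, map_zero] at this)
  refine Subtype.ext (AEEqFun.ext ?_)
  filter_upwards [h1, h2, AEEqFun.coeFn_zero (α := ℝ) (β := Bicomplex) (μ := volume)]
    with x hx1 hx2 hx3
  rw [Submodule.coe_zero, hx3]
  refine ext_parts ?_ ?_
  · rw [hx1, Pi.zero_apply, Pi.zero_apply, ← plusHom_apply, map_zero]
  · rw [hx2, Pi.zero_apply, Pi.zero_apply, ← minusHom_apply, map_zero]

theorem segalBargmannLinear_surjective {σ ν : ℝ} (hσ : 0 < σ) (hν : 0 < ν) :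
    Function.Surjective (segalBargmannLinear hσ hν) := by
  rintro ⟨f, hf⟩
  obtain ⟨u, v, hu, hv, hu2, hv2, rfl⟩ := exists_parts_of_mem_bargmannSpace hν hf
  obtain ⟨φ, hφ, rfl⟩ := exists_segalBargmannC_eq hσ hν hu hu2
  obtain ⟨ψ, hψ, rfl⟩ := exists_segalBargmannC_eq hσ hν hv hv2
  have hF : MemLp (fun x => ofParts (φ x) (ψ x)) 2 (lineGauss σ) := by
    rw [memLp_iff_parts]
    simp only [plusPart_ofParts, minusPart_ofParts]
    exact ⟨hφ, hψ⟩
  obtain ⟨Φ, hΦ⟩ := exists_lineL2_of_memLp hσ hF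
  refine ⟨Φ, Subtype.ext ?_⟩
  refine (segalBargmann_congr_ae σ ν hΦ).trans ?_
  rw [segalBargmann_eq hσ ν hF]
  simp only [plusPart_ofParts, minusPart_ofParts]

theorem lineInner_eq_ofParts {σ : ℝ} (hσ : 0 < σ) {F G : ℝ → Bicomplex}
    (hF : MemLp F 2 (lineGauss σ)) (hG : MemLp G 2 (lineGauss σ)) :
    lineInner σ F G =
      ofParts (∫ x, plusPart (F x) * starRingEnd ℂ (plusPart (G x)) ∂(lineGauss σ))
        (∫ x, minusPart (F x) * starRingEnd ℂ (minusPart (G x)) ∂(lineGauss σ)) := by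
  rw [lineInner_eq hσ]
  refine ext_parts ?_ ?_
  · rw [plusPart_integral_mul_conjStar hF hG, plusPart_ofParts]
  · rw [minusPart_integral_mul_conjStar hF hG, minusPart_ofParts]

theorem bargmannInner_segalBargmann {σ ν : ℝ} (hσ : 0 < σ) (hν : 0 < ν) {F G : ℝ → Bicomplex}
    (hF : MemLp F 2 (lineGauss σ)) (hG : MemLp G 2 (lineGauss σ)) :
    bargmannInner ν (segalBargmann σ ν F) (segalBargmann σ ν G) = lineInner σ F G := by
  have hF' := memLp_iff_parts.mp hF
  have hG' := memLp_iff_parts.mp hG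
  rw [segalBargmann_eq hσ ν hF, segalBargmann_eq hσ ν hG, bargmannInner_ofParts hν
    (differentiable_segalBargmannC hσ hν hF'.1).continuous
    (differentiable_segalBargmannC hσ hν hF'.2).continuous
    (differentiable_segalBargmannC hσ hν hG'.1).continuous
    (differentiable_segalBargmannC hσ hν hG'.2).continuous
    (memLp_segalBargmannC hσ hν hF'.1) (memLp_segalBargmannC hσ hν hF'.2)
    (memLp_segalBargmannC hσ hν hG'.1) (memLp_segalBargmannC hσ hν hG'.2),
    integral_segalBargmannC_mul_conj hσ hν hF'.1 hG'.1,
    integral_segalBargmannC_mul_conj hσ hν hF'.2 hG'.2, lineInner_eq_ofParts hσ hF hG]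

theorem plusPart_hermiteFun (σ : ℝ) (n : ℕ) (x : ℝ) :
    plusPart (hermiteFun σ n x) = hermiteC σ n x := plusHom.commutes _

theorem minusPart_hermiteFun (σ : ℝ) (n : ℕ) (x : ℝ) :
    minusPart (hermiteFun σ n x) = hermiteC σ n x := minusHom.commutes _

theorem memLp_hermiteFun {σ : ℝ} (hσ : 0 < σ) (n : ℕ) :
    MemLp (hermiteFun σ n) 2 (lineGauss σ) := by
  rw [memLp_iff_parts]
  simp only [plusPart_hermiteFun, minusPart_hermiteFun]
  exact ⟨memLp_hermiteC hσ n, memLp_hermiteC hσ n⟩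

theorem monomialFun_eq (ν : ℝ) (n : ℕ) :
    monomialFun ν n = fun Z =>
      ofParts (monomialC ν n (plusPart Z)) (monomialC ν n (minusPart Z)) := by
  ext1 Z
  refine ext_parts ?_ ?_
  · rw [plusPart_ofParts, monomialFun, ← plusHom_apply, map_smul, map_pow]
    rfl
  · rw [minusPart_ofParts, monomialFun, ← minusHom_apply, map_smul, map_pow]
    rfl

theorem segalBargmann_hermiteFun {σ ν : ℝ} (hσ : 0 < σ) (hν : 0 < ν) (n : ℕ) :
    segalBargmann σ ν (hermiteFun σ n) = monomialFun ν n := by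
  rw [segalBargmann_eq hσ ν (memLp_hermiteFun hσ n), monomialFun_eq]
  simp only [plusPart_hermiteFun, minusPart_hermiteFun]
  ext1 Z
  exact congrArg₂ ofParts (segalBargmannC_hermiteC hσ hν n _) (segalBargmannC_hermiteC hσ hν n _)

theorem ofParts_ite (p : Prop) [Decidable p] :
    ofParts (if p then 1 else 0) (if p then 1 else 0) = if p then 1 else 0 := by
  split_ifs
  · exact ofParts_one
  · simp [ofParts]

theorem lineInner_hermiteFun {σ : ℝ} (hσ : 0 < σ) (m n : ℕ) :
    lineInner σ (hermiteFun σ m) (hermiteFun σ n) = if m = n then 1 else 0 := by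
  rw [lineInner_eq_ofParts hσ (memLp_hermiteFun hσ m) (memLp_hermiteFun hσ n)]
  simp only [plusPart_hermiteFun, minusPart_hermiteFun]
  rw [integral_hermiteC_mul hσ, ofParts_ite]

theorem bargmannInner_monomialFun {ν : ℝ} (hν : 0 < ν) (m n : ℕ) :
    bargmannInner ν (monomialFun ν m) (monomialFun ν n) = if m = n then 1 else 0 := by
  have hc (k : ℕ) := (differentiable_monomialC ν k).continuous
  have hm (k : ℕ) := memLp_monomialC hν k
  rw [monomialFun_eq, monomialFun_eq, bargmannInner_ofParts hν (hc m) (hc m) (hc n) (hc n)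
    (hm m) (hm m) (hm n) (hm n), integral_monomialC_mul hν, ofParts_ite]

end Bicomplex

end

open Bicomplex in
/-- The bicomplex Segal–Bargmann transform is a bicomplex-linear bijection of the weighted `L²`
space of the line onto the bicomplex Bargmann space; it preserves the bicomplex inner products and
the norms and sends normalized Hermite functions to normalized monomials. -/
theorem mainTheorem3 (σ ν : ℝ) (hσ : 0 < σ) (hν : 0 < ν) :
    (∀ (φ : lineL2 σ) (Z : Bicomplex),
      MeasureTheory.Integrable (fun x : ℝ => segalBargmannKernel σ ν x Z * φ.1 x)) ∧
    (∃ U : lineL2 σ ≃ₗ[Bicomplex] bargmannSpace ν,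
      (∀ φ : lineL2 σ, (U φ).1 = segalBargmann σ ν φ.1) ∧
      (∀ φ ψ : lineL2 σ, bargmannInner ν (U φ).1 (U ψ).1 = lineInner σ φ.1 ψ.1) ∧
      (∀ φ : lineL2 σ, inducedNorm (bargmannInner ν (U φ).1 (U φ).1) =
        inducedNorm (lineInner σ φ.1 φ.1)) ∧
      (∀ n : ℕ, ∃ ψ : lineL2 σ, (ψ.1 : ℝ → Bicomplex) =ᵐ[MeasureTheory.volume] hermiteFun σ n ∧
        (U ψ).1 = monomialFun ν n)) ∧
    (∀ m n : ℕ, lineInner σ (hermiteFun σ m) (hermiteFun σ n) = if m = n then 1 else 0) ∧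
    (∀ m n : ℕ, bargmannInner ν (monomialFun ν m) (monomialFun ν n) = if m = n then 1 else 0) := by
  have hinner (φ ψ : lineL2 σ) : bargmannInner ν (segalBargmann σ ν φ.1) (segalBargmann σ ν ψ.1) =
      lineInner σ φ.1 ψ.1 :=
    bargmannInner_segalBargmann hσ hν (memLp_of_mem_lineL2 hσ φ) (memLp_of_mem_lineL2 hσ ψ)
  refine ⟨fun φ => integrable_segalBargmannKernel_mul hσ ν (memLp_of_mem_lineL2 hσ φ),
    ⟨LinearEquiv.ofBijective (segalBargmannLinear hσ hν)
      ⟨segalBargmannLinear_injective hσ hν, segalBargmannLinear_surjective hσ hν⟩,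
      fun φ => rfl, hinner, fun φ => congrArg inducedNorm (hinner φ φ), fun n => ?_⟩,
    lineInner_hermiteFun hσ, bargmannInner_monomialFun hν⟩
  -- The transform depends only on the almost everywhere class, so any class represented by the
  -- Hermite function serves.
  obtain ⟨ψ, hψ⟩ := exists_lineL2_of_memLp hσ (memLp_hermiteFun hσ n)
  exact ⟨ψ, hψ, (segalBargmann_congr_ae σ ν hψ).trans (segalBargmann_hermiteFun hσ hν n)⟩
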